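/- **Setting.** Let $f(x;\theta)\in\mathbb{R}$ be a classical neural network including its scalar loss (any real function of an input $x\in\mathbb{R}^d$ and of $n_\theta$ trainable parameters), and let $\theta$ be the current parameters. The input $X$ has a finitely supported distribution $p_X$ on $d$-tuples of fixed-point numbers with $c_1$ integer bits, $c_2$ fractional bits and a sign bit. For every $x$ with $p_X(x)>0$ let $f(x;\cdot)$ be differentiable at $\theta$, with gradient $\nabla f(x)\in\mathbb{R}^{n_\theta}$ with respect to the parameters, and put $g_{\max}=\max_{x:\,p_X(x)>0}\lVert\nabla f(x)\rVert_\infty^2$. For $v\in\mathbb{R}^{n_\theta}$ let $U'_{\mathrm{NN},c}(v)$ be the unitary $|x\rangle|y\rangle\mapsto|x\rangle|y\oplus \nabla f(x)\cdot v\rangle$, where $\nabla f(x)\cdot v$ is rounded to a nearest fixed-point number and $\oplus$ is bitwise XOR. Quantum algorithms are classically controlled quantum circuits with work qubits, gates that do not depend on $f,\theta,p_X$, and measurements in the computational basis. They may use a unitary $U_p$ with $U_p|0\cdots0\rangle=\sum_x\sqrt{p_X(x)}\,|x\rangle$ and its inverse, and they make queries to $U'_{\mathrm{NN},c}(v)$.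 Only these queries are counted. **Statement.** There are universal constants $C>0$ and $c\in\mathbb{N}$ such that the following holds for all $n_\theta$, all $g\ge 0$ and all $\epsilon>0$, with $L=\log^c\!\big(3+n_\theta\sqrt{g}/\epsilon\big)$. If $c_1,c_2$ are large enough depending on $n_\theta,g,\epsilon$ (so that numerical errors are negligible), then for every $d$ there are a number $m$ of outer samples and a family of quantum algorithms $(A_v)_{v\in\mathbb{R}^{n_\theta}}$ with real outputs, depending only on $n_\theta,g,\epsilon,d,c_1,c_2$, such that for all $f,\theta,p_X,U_p$ as above with $g_{\max}\le g$: 1. (Inner loop, quantum-accelerated Monte Carlo for fixed $v$.) For every $v$, $A_v$ makes at most $C\,\frac{\sqrt{g\,n_\theta}\,\lVert v\rVert_2}{\epsilon}\,L$ queries to $U'_{\mathrm{NN},c}(v)$. If no $\nabla f(x)\cdot v$ with $p_X(x)>0$ exceeds the fixed-point range $2^{c_1}-2^{-c_2}$ in absolute value, then with probability at least $0.99$ its output $w$ satisfies $|w-\mathbb{E}_X[\nabla f(X)\cdot v]|\le\epsilon$. 2. (Outer loop, classical Monte Carlo over $v$.) Let $v_1,\dots,v_m\in\mathbb{R}^{n_\theta}$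 have iid $\mathcal N(0,1)$ entries and, given these, let $w_1,\dots,w_m$ be the outputs of independent runs of $A_{v_1},\dots,A_{v_m}$. Then with probability at least $0.99$, simultaneously $$\Big\lVert \frac1m\sum_{i=1}^m w_i v_i-\mathbb{E}_{X,v}\big[(\nabla f(X)\cdot v)\,v\big]\Big\rVert_\infty\le\epsilon$$ (for $m=0$ the average is read as $0$), and the total number of queries is at most $$C\,\frac{n_\theta^{2.5}\,g^{1.5}}{\epsilon^3}\,L .$$ Moreover $\mathbb{E}_{X,v}[(\nabla f(X)\cdot v)\,v]=\nabla_\theta\,\mathbb{E}_X[f(X;\theta)]$, so this estimates the gradient. In short, the gradient is estimated to $\ell_\infty$ error $\epsilon$ with probability $0.99$ using $\tilde O(n_\theta^{2.5}g_{\max}^{1.5}/\epsilon^3)$ queries to $U'_{\mathrm{NN},c}$. -/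

import Mathlib

open MeasureTheory ProbabilityTheory
open scoped ENNReal Matrix

noncomputable section

namespace ForwardGradient

/-! ### Fixed-point numbers -/

/-- A fixed-point number with `c₁` integer bits `a`, `c₂` fractional bits `b` and a sign bit `s`,
as the bit string `(a, b, s)`. -/
abbrev FixedPt (c₁ c₂ : ℕ) : Type := (Fin c₁ → Bool) × (Fin c₂ → Bool) × Bool

namespace FixedPt

variable {c₁ c₂ : ℕ}

/-- The all-zero bit string. -/
def zero : FixedPt c₁ c₂ := (fun _ => false, fun _ => false, false)

/-- Bitwise exclusive or. -/
def xor (y z : FixedPt c₁ c₂) : FixedPt c₁ c₂ :=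
  (fun i => Bool.xor (y.1 i) (z.1 i), fun i => Bool.xor (y.2.1 i) (z.2.1 i),
    Bool.xor y.2.2 z.2.2)

/-- The rational number `(-1)^s (∑ i, 2^i a_i + ∑ i, 2^{-(i+1)} b_i)` that a bit string stands
for. -/
def value (y : FixedPt c₁ c₂) : ℝ :=
  (if y.2.2 then -1 else 1) *
    (∑ i, (if y.1 i then (2 : ℝ) ^ (i : ℕ) else 0) +
      ∑ i, (if y.2.1 i then ((2 : ℝ) ^ ((i : ℕ) + 1))⁻¹ else 0))

/-- A bit string whose value is nearest to `r` (so numbers outside the range saturate). -/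
def encode (c₁ c₂ : ℕ) (r : ℝ) : FixedPt c₁ c₂ :=
  haveI : Nonempty (FixedPt c₁ c₂) := ⟨zero⟩
  Classical.choose (Finite.exists_min fun y : FixedPt c₁ c₂ => |y.value - r|)

/-- The largest representable number, `2^{c₁} - 2^{-c₂}`. -/
def range (c₁ c₂ : ℕ) : ℝ := (2 : ℝ) ^ c₁ - ((2 : ℝ) ^ c₂)⁻¹

theorem xor_xor_cancel_right (y z : FixedPt c₁ c₂) : (y.xor z).xor z = y := by
  ext <;> simp [xor]

end FixedPt

/-! ### Registers, circuits and hybrid algorithms -/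

/-- Basis labels of the register holding the network input, a `d`-tuple of fixed-point numbers. -/
abbrev XReg (d c₁ c₂ : ℕ) : Type := Fin d → FixedPt c₁ c₂

/-- The point of `ℝ^d` that a basis label of the input register stands for. -/
def XReg.point {d c₁ c₂ : ℕ} (x : XReg d c₁ c₂) : Fin d → ℝ := fun i => (x i).value

/-- Computational basis of the whole machine: input register, output register of the queried
unitary, and `a` work qubits. -/
abbrev Basis (d c₁ c₂ a : ℕ) : Type := XReg d c₁ c₂ × FixedPt c₁ c₂ × (Fin a → Bool)

instance (c₁ c₂ : ℕ) : DecidableEq (FixedPt c₁ c₂) := by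
  unfold FixedPt
  infer_instance

instance (d c₁ c₂ : ℕ) : DecidableEq (XReg d c₁ c₂) := by
  unfold XReg
  infer_instance

instance (d c₁ c₂ a : ℕ) : DecidableEq (Basis d c₁ c₂ a) := by
  unfold Basis
  infer_instance

/-- The label `|0⋯0⟩` of the input register. -/
def XReg.zero {d c₁ c₂ : ℕ} : XReg d c₁ c₂ := fun _ => FixedPt.zero

/-- The all-zero label of the whole machine. -/
def Basis.zero {d c₁ c₂ a : ℕ} : Basis d c₁ c₂ a :=
  (XReg.zero, FixedPt.zero, fun _ => false)

/-- One step of a circuit: a fixed unitary gate, a use of the distribution-loading unitary or of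
its inverse, or a query to the unitary that evaluates the function of interest. -/
inductive Step (d c₁ c₂ a : ℕ) : Type
  | gate (W : Matrix.unitaryGroup (Basis d c₁ c₂ a) ℂ)
  | load
  | unload
  | query

/-- The black boxes that a circuit may use: a unitary `loader` on the input register, and the
classical function `h` behind the query unitary `|x⟩|y⟩ ↦ |x⟩|y ⊕ h x⟩`. -/
structure Oracle (d c₁ c₂ : ℕ) where
  loader : Matrix.unitaryGroup (XReg d c₁ c₂) ℂ
  h : XReg d c₁ c₂ → FixedPt c₁ c₂

/-- The linear action of a matrix on the input register, the identity on the other registers. -/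
def applyX {d c₁ c₂ a : ℕ} (M : Matrix (XReg d c₁ c₂) (XReg d c₁ c₂) ℂ)
    (ψ : Basis d c₁ c₂ a → ℂ) : Basis d c₁ c₂ a → ℂ :=
  fun b => ∑ x', M b.1 x' * ψ (x', b.2)

/-- The action of one step on a state vector. As bitwise exclusive or is an involution, the
amplitude of `(x, y)` after a query is the one of `(x, y ⊕ h x)` before it. -/
def Step.act {d c₁ c₂ a : ℕ} (O : Oracle d c₁ c₂) :
    Step d c₁ c₂ a → (Basis d c₁ c₂ a → ℂ) → (Basis d c₁ c₂ a → ℂ)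
  | .gate W, ψ => (W : Matrix _ _ ℂ) *ᵥ ψ
  | .load, ψ => applyX (O.loader : Matrix _ _ ℂ) ψ
  | .unload, ψ => applyX ((O.loader : Matrix _ _ ℂ)ᴴ) ψ
  | .query, ψ => fun b => ψ (b.1, b.2.1.xor (O.h b.1), b.2.2)

/-- A circuit is a finite sequence of steps, performed from left to right. -/
abbrev Circuit (d c₁ c₂ a : ℕ) : Type := List (Step d c₁ c₂ a)

/-- The number of queries that a step makes. -/
def Step.queries {d c₁ c₂ a : ℕ} : Step d c₁ c₂ a → ℕ
  | .query => 1
  | _ => 0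

/-- The number of queries that a circuit makes. -/
def Circuit.queries {d c₁ c₂ a : ℕ} (K : Circuit d c₁ c₂ a) : ℕ := (K.map Step.queries).sum

/-- The final state of a circuit started in `|0⋯0⟩`. -/
def Circuit.state {d c₁ c₂ a : ℕ} (O : Oracle d c₁ c₂) (K : Circuit d c₁ c₂ a) :
    Basis d c₁ c₂ a → ℂ :=
  K.foldl (fun ψ s => s.act O ψ) (Pi.single Basis.zero 1)

theorem sum_norm_sq_mulVec {ι : Type*} [Fintype ι] [DecidableEq ι] {M : Matrix ι ι ℂ}
    (hM : Mᴴ * M = 1) (ψ : ι → ℂ) : ∑ i, ‖(M *ᵥ ψ) i‖ ^ 2 = ∑ i, ‖ψ i‖ ^ 2 := by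
  have key : ∀ φ : ι → ℂ, ((∑ i, ‖φ i‖ ^ 2 : ℝ) : ℂ) = star φ ⬝ᵥ φ := by
    intro φ
    simp [dotProduct, Complex.conj_mul']
  have h : ((∑ i, ‖(M *ᵥ ψ) i‖ ^ 2 : ℝ) : ℂ) = ((∑ i, ‖ψ i‖ ^ 2 : ℝ) : ℂ) := by
    rw [key, key, Matrix.star_mulVec, Matrix.dotProduct_mulVec, Matrix.vecMul_vecMul, hM,
      Matrix.vecMul_one]
  exact_mod_cast h

theorem sum_norm_sq_applyX {d c₁ c₂ a : ℕ} {M : Matrix (XReg d c₁ c₂) (XReg d c₁ c₂) ℂ}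
    (hM : Mᴴ * M = 1) (ψ : Basis d c₁ c₂ a → ℂ) :
    ∑ b, ‖applyX M ψ b‖ ^ 2 = ∑ b, ‖ψ b‖ ^ 2 := by
  have split : ∀ φ : Basis d c₁ c₂ a → ℂ, ∑ b, ‖φ b‖ ^ 2 =
      ∑ r : FixedPt c₁ c₂ × (Fin a → Bool), ∑ x : XReg d c₁ c₂, ‖φ (x, r)‖ ^ 2 := fun φ =>
    Fintype.sum_prod_type_right fun b : Basis d c₁ c₂ a => ‖φ b‖ ^ 2
  rw [split, split]
  refine Finset.sum_congr rfl fun r _ => ?_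
  exact sum_norm_sq_mulVec hM fun x => ψ (x, r)

theorem Step.sum_norm_sq_act {d c₁ c₂ a : ℕ} (O : Oracle d c₁ c₂) (s : Step d c₁ c₂ a)
    (ψ : Basis d c₁ c₂ a → ℂ) : ∑ b, ‖s.act O ψ b‖ ^ 2 = ∑ b, ‖ψ b‖ ^ 2 := by
  cases s with
  | gate W => exact sum_norm_sq_mulVec (Matrix.mem_unitaryGroup_iff'.1 W.2) ψ
  | load => exact sum_norm_sq_applyX (Matrix.mem_unitaryGroup_iff'.1 O.loader.2) ψ
  | unload =>
    refine sum_norm_sq_applyX ?_ ψ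
    rw [Matrix.conjTranspose_conjTranspose]
    exact Matrix.mem_unitaryGroup_iff.1 O.loader.2
  | query =>
    have hinv : Function.Involutive fun b : Basis d c₁ c₂ a =>
        ((b.1, b.2.1.xor (O.h b.1), b.2.2) : Basis d c₁ c₂ a) := by
      intro b
      simp only [FixedPt.xor_xor_cancel_right]
    exact Equiv.sum_comp (hinv.toPerm _) fun b => ‖ψ b‖ ^ 2

theorem Circuit.sum_norm_sq_state {d c₁ c₂ a : ℕ} (O : Oracle d c₁ c₂)
    (K : Circuit d c₁ c₂ a) : ∑ b, ‖K.state O b‖ ^ 2 = 1 := by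
  have gen : ∀ (K : Circuit d c₁ c₂ a) (ψ : Basis d c₁ c₂ a → ℂ),
      ∑ b, ‖K.foldl (fun ψ s => s.act O ψ) ψ b‖ ^ 2 = ∑ b, ‖ψ b‖ ^ 2 := by
    intro K
    induction K with
    | nil => intro ψ; rfl
    | cons s K ih => intro ψ; rw [List.foldl_cons, ih, Step.sum_norm_sq_act]
  rw [Circuit.state, gen, Finset.sum_eq_single Basis.zero]
  · simp
  · intro b _ hb
    simp [Pi.single_eq_of_ne hb]
  · intro h
    exact absurd (Finset.mem_univ _) h

/-- The distribution of the outcome when the final state of a circuit is measured in the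
computational basis. -/
def Circuit.outcome {d c₁ c₂ a : ℕ} (O : Oracle d c₁ c₂) (K : Circuit d c₁ c₂ a) :
    PMF (Basis d c₁ c₂ a) :=
  PMF.ofFintype (fun b => ENNReal.ofReal (‖K.state O b‖ ^ 2)) <| by
    rw [← ENNReal.ofReal_sum_of_nonneg fun b _ => sq_nonneg _, Circuit.sum_norm_sq_state,
      ENNReal.ofReal_one]

/-- A quantum algorithm with classical control that outputs a real number: it either stops with an
output, or runs a circuit, measures, and goes on depending on the outcome. -/
inductive QAlgorithm (d c₁ c₂ : ℕ) : Type
  | ret (w : ℝ)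
  | run (a : ℕ) (K : Circuit d c₁ c₂ a) (next : Basis d c₁ c₂ a → QAlgorithm d c₁ c₂)

/-- The law of the output of an algorithm with given black boxes. -/
def QAlgorithm.law {d c₁ c₂ : ℕ} (O : Oracle d c₁ c₂) : QAlgorithm d c₁ c₂ → PMF ℝ
  | .ret w => PMF.pure w
  | .run _ K next => (K.outcome O).bind fun b => (next b).law O

/-- The number of queries that an algorithm makes, in the worst case over measurement outcomes. -/
def QAlgorithm.queries {d c₁ c₂ : ℕ} : QAlgorithm d c₁ c₂ → ℕ
  | .ret _ => 0
  | .run _ K next => K.queries + Finset.univ.sup fun b => (next b).queries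

/-! ### The learning problem -/

/-- A parametrised scalar function (the network together with its loss) `f x θ` with `n` trainable
parameters, the current parameters `θ`, and a distribution `p` of the network input, together with
a unitary `loader` that prepares `∑ x, √(p x) |x⟩` from `|0⋯0⟩`. -/
structure Problem (d n c₁ c₂ : ℕ) where
  f : (Fin d → ℝ) → EuclideanSpace ℝ (Fin n) → ℝ
  θ : EuclideanSpace ℝ (Fin n)
  p : XReg d c₁ c₂ → ℝ
  p_nonneg : ∀ x, 0 ≤ p x
  p_sum : ∑ x, p x = 1
  differentiableAt : ∀ x, 0 < p x → DifferentiableAt ℝ (f x.point) θ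
  loader : Matrix.unitaryGroup (XReg d c₁ c₂) ℂ
  loader_zero : ∀ x,
    (loader : Matrix (XReg d c₁ c₂) (XReg d c₁ c₂) ℂ) x XReg.zero = (√(p x) : ℝ)

namespace Problem

variable {d n c₁ c₂ : ℕ} (P : Problem d n c₁ c₂)

/-- The gradient with respect to the parameters, at input `x`. As an element of `Fin n → ℝ` it
carries the `ℓ∞` norm. -/
def grad (x : XReg d c₁ c₂) : Fin n → ℝ := fun k => gradient (P.f x.point) P.θ k

/-- The squared `ℓ∞` norm of the gradient, maximised over the inputs that occur. -/
def gMax : ℝ := ⨆ x : {x : XReg d c₁ c₂ // 0 < P.p x}, ‖P.grad x‖ ^ 2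

/-- The directional derivative `∇f(x) · v`. -/
def dirDeriv (v : Fin n → ℝ) (x : XReg d c₁ c₂) : ℝ := P.grad x ⬝ᵥ v

/-- The mean of the directional derivative over the input, for a fixed `v`. -/
def meanDirDeriv (v : Fin n → ℝ) : ℝ := ∑ x, P.p x * P.dirDeriv v x

/-- The black boxes for a fixed `v`: the loading unitary, and the unitary
`|x⟩|y⟩ ↦ |x⟩|y ⊕ ∇f(x)·v⟩` with `∇f(x)·v` in fixed-point encoding. -/
def oracle (v : Fin n → ℝ) : Oracle d c₁ c₂ where
  loader := P.loader
  h x := FixedPt.encode c₁ c₂ (P.dirDeriv v x)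

end Problem

/-- The law of a vector with `n` iid standard normal entries. -/
def gaussianVec (n : ℕ) : Measure (Fin n → ℝ) := Measure.pi fun _ => gaussianReal 0 1

instance (n : ℕ) : IsProbabilityMeasure (gaussianVec n) := by
  unfold gaussianVec
  infer_instance

/-- The Euclidean norm of `v`. -/
def norm2 {n : ℕ} (v : Fin n → ℝ) : ℝ := √(∑ k, v k ^ 2)

/-- The mean of the forward gradient `(∇f(X) · v) v` over the input and over `v`. -/
def Problem.meanForwardGrad {d n c₁ c₂ : ℕ} (P : Problem d n c₁ c₂) : Fin n → ℝ :=
  fun k => ∫ v, ∑ x, P.p x * (P.dirDeriv v x * v k) ∂(gaussianVec n)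

/-- The gradient of the expected loss at the current parameters. -/
def Problem.gradMeanLoss {d n c₁ c₂ : ℕ} (P : Problem d n c₁ c₂) : Fin n → ℝ :=
  fun k => gradient (fun θ => ∑ x, P.p x * P.f x.point θ) P.θ k

/-- Outer loop: the empirical mean of the forward gradients `w i • v i`, where `w i` is the inner
estimate of the directional derivative along `v i`. -/
def empiricalMean {n m : ℕ} (v : Fin m → Fin n → ℝ) (w : Fin m → ℝ) : Fin n → ℝ :=
  (m : ℝ)⁻¹ • ∑ i, w i • v i

/-- The joint success probability of the nested procedure: `v 1, …, v m` are independent Gaussian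
samples; given these, the inner algorithm `A (v i)` is run independently for each `i`, with outputs
`w 1, …, w m`; the probability is that of the event `E v w`. -/
def nestedProb {d n c₁ c₂ : ℕ} (P : Problem d n c₁ c₂) (m : ℕ)
    (A : (Fin n → ℝ) → QAlgorithm d c₁ c₂)
    (E : (Fin m → Fin n → ℝ) → (Fin m → ℝ) → Prop) : ℝ≥0∞ :=
  ∫⁻ v, (Measure.pi fun i => ((A (v i)).law (P.oracle (v i))).toMeasure) {w | E v w}
    ∂(Measure.pi fun _ : Fin m => gaussianVec n)

end ForwardGradient

end

/-! Inner loop. Conjugating a reflection on one work qubit by the queries and the loader gives a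
self-inverse unitary whose amplitude at the all-zero state `e` is the mean of a bounded function `t`
of the queried value (`walkUnitary_zero`). Alternating it with the reflection about `e` satisfies
the Chebyshev recursion, so after `M` steps and `2 * M` queries that amplitude is `cos (M * θ)`,
where `cos θ` is the mean (`state_walk_zero`). With `M` of order `1 / r` this resolves a mean at
scale `r`, quadratically cheaper than sampling.

The mean is located by trisection rather than by phase estimation. If it lies in `[c - r, c + r]`,
then `t` is shifted so that the all-zero outcome has probability exactly `1 / 2` when the mean
equals `c`, and probability bounded away from `1 / 2` when the mean is in an outer third
(`stage_prob_le`, `le_stage_prob`). A majority vote discards an outer third not containing the mean,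
and in the middle third either answer is correct. The costs of the stages grow geometrically, so the
last one dominates and an accuracy `ε` costs about `√(g * n) * ‖v‖ / ε` queries, times the logarithm
of the inverse failure probability (`exists_estimator`).

Outer loop. For a Gaussian `v` and a fixed mean gradient `u`, the vector `(u · v) v` has mean `u`,
and the fourth central moments of its coordinates are `O(‖u‖ ^ 4)`, hence `O((n * g) ^ 2)`. Markov's
inequality for the fourth power and a union bound over `n` coordinates require `n * (n * g) ^ 2 / (m
^ 2 * ε ^ 4)` to be small, so `m` of order `n ^ 1.5 * g / ε ^ 2` suffices
(`measure_compl_goodDirections_outerSamples_le`); the variance alone would cost another factor `√n`.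
The same moment bound for the basis vectors controls all `∑ i, v i k ^ 2`. This limits the effect of
the inner errors, keeps the directional derivatives in the fixed-point range, and gives `∑ i, ‖v i‖
= O(m * √n)`. Multiplying by the inner cost yields `n ^ 2.5 * g ^ 1.5 / ε ^ 3`. -/

noncomputable section

namespace ForwardGradient

/-! ### Rounding to fixed-point numbers -/

namespace FixedPt

theorem exists_integerBits (c : ℕ) : ∀ r : ℝ, 0 ≤ r → r ≤ 2 ^ c →
    ∃ a : Fin c → Bool, 0 ≤ r - ∑ i, (if a i then (2 : ℝ) ^ (i : ℕ) else 0) ∧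
      r - ∑ i, (if a i then (2 : ℝ) ^ (i : ℕ) else 0) ≤ 1 := by
  induction c with
  | zero => intro r h0 h1; exact ⟨fun _ => false, by simpa using h0, by simpa using h1⟩
  | succ c ih =>
    intro r h0 h1
    rcases le_total r (2 ^ c) with h | h
    · obtain ⟨a, ha⟩ := ih r h0 h
      exact ⟨Fin.snoc a false, by simpa [Fin.sum_univ_castSucc] using ha⟩
    · obtain ⟨a, ha⟩ := ih (r - 2 ^ c) (by linarith) (by rw [pow_succ] at h1; linarith)
      refine ⟨Fin.snoc a true, ?_⟩
      simp only [Fin.sum_univ_castSucc, Fin.snoc_castSucc, Fin.val_castSucc, Fin.snoc_last,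
        Fin.val_last, if_true]
      constructor <;> linarith [ha.1, ha.2]

theorem exists_fractionalBits (c : ℕ) : ∀ r : ℝ, 0 ≤ r → r ≤ 1 →
    ∃ b : Fin c → Bool, 0 ≤ r - ∑ i, (if b i then ((2 : ℝ) ^ ((i : ℕ) + 1))⁻¹ else 0) ∧
      r - ∑ i, (if b i then ((2 : ℝ) ^ ((i : ℕ) + 1))⁻¹ else 0) ≤ ((2 : ℝ) ^ c)⁻¹ := by
  induction c with
  | zero => intro r h0 h1; exact ⟨fun _ => false, by simpa using h0, by simpa using h1⟩
  | succ c ih =>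
    have split : ∀ (b₀ : Bool) (b : Fin c → Bool),
        ∑ i, (if (Fin.cons b₀ b : Fin (c + 1) → Bool) i then ((2 : ℝ) ^ ((i : ℕ) + 1))⁻¹ else 0) =
          (if b₀ then 2⁻¹ else 0) +
            2⁻¹ * ∑ i, (if b i then ((2 : ℝ) ^ ((i : ℕ) + 1))⁻¹ else 0) := by
      intro b₀ b
      simp only [Fin.sum_univ_succ, Fin.cons_zero, Fin.cons_succ, Fin.val_zero, Fin.val_succ,
        Finset.mul_sum, zero_add, pow_one]
      congr 1
      refine Finset.sum_congr rfl fun i _ => ?_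
      split_ifs
      · rw [pow_succ _ ((i : ℕ) + 1), mul_inv, mul_comm]
      · simp
    have hpow : ((2 : ℝ) ^ (c + 1))⁻¹ = 2⁻¹ * ((2 : ℝ) ^ c)⁻¹ := by
      rw [pow_succ, mul_inv, mul_comm]
    intro r h0 h1
    rcases le_total r 2⁻¹ with h | h
    · obtain ⟨b, hb⟩ := ih (2 * r) (by linarith) (by linarith)
      refine ⟨Fin.cons false b, ?_⟩
      rw [split, hpow]
      simp only [Bool.false_eq_true, if_false]
      constructor <;> linarith [hb.1, hb.2]
    · obtain ⟨b, hb⟩ := ih (2 * r - 1) (by linarith) (by linarith)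
      refine ⟨Fin.cons true b, ?_⟩
      rw [split, hpow]
      simp only [if_true]
      constructor <;> linarith [hb.1, hb.2]

theorem exists_abs_value_sub_le {c₁ c₂ : ℕ} {r : ℝ} (hr : |r| ≤ 2 ^ c₁) :
    ∃ y : FixedPt c₁ c₂, |y.value - r| ≤ ((2 : ℝ) ^ c₂)⁻¹ := by
  obtain ⟨a, ha₀, ha₁⟩ := exists_integerBits c₁ |r| (abs_nonneg r) hr
  obtain ⟨b, hb₀, hb₁⟩ := exists_fractionalBits c₂ _ ha₀ ha₁
  rcases le_total 0 r with h | h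
  · refine ⟨(a, b, false), ?_⟩
    rw [abs_of_nonneg h] at hb₀ hb₁
    simp only [value, Bool.false_eq_true, if_false, one_mul]
    rw [abs_sub_comm, abs_of_nonneg] <;> linarith
  · refine ⟨(a, b, true), ?_⟩
    rw [abs_of_nonpos h] at hb₀ hb₁
    simp only [value, if_true]
    rw [abs_of_nonneg] <;> linarith

theorem abs_value_encode_sub_le {c₁ c₂ : ℕ} {r : ℝ} (hr : |r| ≤ range c₁ c₂) :
    |(encode c₁ c₂ r).value - r| ≤ ((2 : ℝ) ^ c₂)⁻¹ := by
  have h0 : (0 : ℝ) ≤ ((2 : ℝ) ^ c₂)⁻¹ := by positivity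
  obtain ⟨y, hy⟩ := exists_abs_value_sub_le (c₁ := c₁) (c₂ := c₂) (r := r)
    (hr.trans (by unfold range; linarith))
  have : Nonempty (FixedPt c₁ c₂) := ⟨zero⟩
  exact (Classical.choose_spec
    (Finite.exists_min fun y : FixedPt c₁ c₂ => |y.value - r|) y).trans hy

@[simp]
theorem zero_xor {c₁ c₂ : ℕ} (y : FixedPt c₁ c₂) : zero.xor y = y := by
  ext <;> simp [xor, zero]

@[simp]
theorem xor_self {c₁ c₂ : ℕ} (y : FixedPt c₁ c₂) : y.xor y = zero := by
  ext <;> simp [xor, zero]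

end FixedPt

/-! ### Output probabilities of hybrid algorithms -/

variable {d c₁ c₂ : ℕ}

/-- The probability, as a real number, that the output of an algorithm lies in `s`. -/
def QAlgorithm.prob (O : Oracle d c₁ c₂) (s : Set ℝ) : QAlgorithm d c₁ c₂ → ℝ
  | .ret w => s.indicator 1 w
  | .run _ K next => ∑ b, ‖K.state O b‖ ^ 2 * (next b).prob O s

theorem QAlgorithm.prob_nonneg (O : Oracle d c₁ c₂) (s : Set ℝ) (A : QAlgorithm d c₁ c₂) :
    0 ≤ A.prob O s := by
  induction A with
  | ret w => exact Set.indicator_nonneg (fun _ _ => zero_le_one) w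
  | run a K next ih => exact Finset.sum_nonneg fun b _ => mul_nonneg (sq_nonneg _) (ih b)

theorem QAlgorithm.prob_le_one (O : Oracle d c₁ c₂) (s : Set ℝ) (A : QAlgorithm d c₁ c₂) :
    A.prob O s ≤ 1 := by
  induction A with
  | ret w => exact Set.indicator_le_self' (fun _ _ => zero_le_one) w
  | run a K next ih =>
    rw [← Circuit.sum_norm_sq_state O K]
    exact Finset.sum_le_sum fun b _ => mul_le_of_le_one_right (sq_nonneg _) (ih b)

theorem QAlgorithm.toMeasure_law (O : Oracle d c₁ c₂) {s : Set ℝ} (hs : MeasurableSet s)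
    (A : QAlgorithm d c₁ c₂) : (A.law O).toMeasure s = ENNReal.ofReal (A.prob O s) := by
  induction A with
  | ret w =>
    rw [law, PMF.toMeasure_pure_apply _ _ hs, prob]
    by_cases h : w ∈ s <;> simp [h]
  | run a K next ih =>
    rw [law, PMF.toMeasure_bind_apply _ _ _ hs, tsum_fintype, prob, ENNReal.ofReal_sum_of_nonneg
      fun b _ => mul_nonneg (sq_nonneg _) (QAlgorithm.prob_nonneg O s _)]
    refine Finset.sum_congr rfl fun b _ => ?_
    rw [ih, ENNReal.ofReal_mul (sq_nonneg _)]
    rfl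

theorem QAlgorithm.le_toMeasure_law (O : Oracle d c₁ c₂) {s : Set ℝ} (hs : MeasurableSet s)
    (A : QAlgorithm d c₁ c₂) {δ : ℝ} (h : A.prob O sᶜ ≤ δ) :
    ENNReal.ofReal (1 - δ) ≤ (A.law O).toMeasure s := by
  have h1 := prob_compl_eq_one_sub (μ := (A.law O).toMeasure) hs.compl
  rw [compl_compl, QAlgorithm.toMeasure_law O hs.compl] at h1
  rw [h1, ← ENNReal.ofReal_one, ← ENNReal.ofReal_sub _ (QAlgorithm.prob_nonneg O _ A)]
  exact ENNReal.ofReal_le_ofReal (by linarith)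

/-! ### Repeating a circuit and counting all-zero outcomes -/

/-- Run the circuit `K` for `N` times, count the all-zero outcomes on top of `s`, and go on
depending on the count. -/
def QAlgorithm.count {a : ℕ} (K : Circuit d c₁ c₂ a) (next : ℕ → QAlgorithm d c₁ c₂) :
    ℕ → ℕ → QAlgorithm d c₁ c₂
  | 0, s => next s
  | N + 1, s => .run a K fun b => count K next N (if b = Basis.zero then s + 1 else s)

theorem QAlgorithm.queries_count_le {a : ℕ} (K : Circuit d c₁ c₂ a)
    (next : ℕ → QAlgorithm d c₁ c₂) {B : ℕ} (hB : ∀ s, (next s).queries ≤ B) (N s : ℕ) :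
    (QAlgorithm.count K next N s).queries ≤ N * K.queries + B := by
  induction N generalizing s with
  | zero => simpa [count] using hB s
  | succ N ih =>
    have h : (Finset.univ.sup fun b : Basis d c₁ c₂ a =>
        (count K next N (if b = Basis.zero then s + 1 else s)).queries) ≤ N * K.queries + B :=
      Finset.sup_le fun b _ => ih _
    rw [count, queries]
    linarith

/-- The count is binomial, and `(1 + q * (x - 1)) ^ N` is its generating function at `x`. This
becomes a Chernoff bound once `A * x ^ s` is chosen to dominate the indicator of a wrong vote. -/
theorem QAlgorithm.prob_count_le (O : Oracle d c₁ c₂) (S : Set ℝ) {a : ℕ}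
    (K : Circuit d c₁ c₂ a) (next : ℕ → QAlgorithm d c₁ c₂) {b₀ A x : ℝ}
    (h : ∀ s, (next s).prob O S ≤ b₀ + A * x ^ s) (N s : ℕ) :
    (QAlgorithm.count K next N s).prob O S ≤
      b₀ + A * x ^ s * (1 + ‖K.state O Basis.zero‖ ^ 2 * (x - 1)) ^ N := by
  induction N generalizing s with
  | zero => simpa [count] using h s
  | succ N ih =>
    set q := ‖K.state O Basis.zero‖ ^ 2 with hq
    set y := 1 + q * (x - 1) with hy
    rw [count, prob]
    calc ∑ b, ‖K.state O b‖ ^ 2 *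
          (count K next N (if b = Basis.zero then s + 1 else s)).prob O S
        ≤ ∑ b, (‖K.state O b‖ ^ 2 * (b₀ + A * x ^ s * y ^ N) +
            if b = Basis.zero then q * (A * x ^ s * (x - 1) * y ^ N) else 0) := by
          refine Finset.sum_le_sum fun b _ => ?_
          split_ifs with hb
          · have := mul_le_mul_of_nonneg_left (ih (s + 1)) (sq_nonneg ‖K.state O b‖)
            refine this.trans (le_of_eq ?_)
            rw [hb, ← hq]; ring
          · simpa using mul_le_mul_of_nonneg_left (ih s) (sq_nonneg ‖K.state O b‖)
      _ = b₀ + A * x ^ s * y ^ (N + 1) := by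
          rw [Finset.sum_add_distrib, ← Finset.sum_mul, Circuit.sum_norm_sq_state,
            Finset.sum_ite_eq' Finset.univ Basis.zero]
          simp only [Finset.mem_univ, if_true]
          rw [pow_succ, hy]; ring

/-! ### A circuit that evaluates a Chebyshev polynomial of a mean -/

/-- Flip the work qubit. -/
def Basis.flip (b : Basis d c₁ c₂ 1) : Basis d c₁ c₂ 1 := (b.1, b.2.1, fun i => !b.2.2 i)

@[simp]
theorem Basis.flip_flip (b : Basis d c₁ c₂ 1) : b.flip.flip = b := by
  simp [Basis.flip]

theorem Basis.flip_ne (b : Basis d c₁ c₂ 1) : b.flip ≠ b := by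
  intro h
  have := congrFun (congrArg (fun b : Basis d c₁ c₂ 1 => b.2.2) h) 0
  simp [Basis.flip] at this

/-- The matrix that acts on the work qubit by the reflection `[[t, √(1 - t²)], [√(1 - t²), -t]]`,
where `t` depends on the output register. -/
def reflMatrix (t : FixedPt c₁ c₂ → ℝ) : Matrix (Basis d c₁ c₂ 1) (Basis d c₁ c₂ 1) ℂ :=
  fun b b' => (if b' = b then (((if b.2.2 0 then -1 else 1) * t b.2.1 : ℝ) : ℂ) else 0) +
    if b' = b.flip then ((√(1 - t b.2.1 ^ 2) : ℝ) : ℂ) else 0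

theorem reflMatrix_mulVec (t : FixedPt c₁ c₂ → ℝ) (ψ : Basis d c₁ c₂ 1 → ℂ)
    (b : Basis d c₁ c₂ 1) : (reflMatrix t *ᵥ ψ) b =
      (((if b.2.2 0 then -1 else 1) * t b.2.1 : ℝ) : ℂ) * ψ b +
        ((√(1 - t b.2.1 ^ 2) : ℝ) : ℂ) * ψ b.flip := by
  simp [Matrix.mulVec, dotProduct, reflMatrix, add_mul, Finset.sum_add_distrib]

theorem reflMatrix_mulVec_mulVec {t : FixedPt c₁ c₂ → ℝ} (ht : ∀ y, |t y| ≤ 1)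
    (ψ : Basis d c₁ c₂ 1 → ℂ) : reflMatrix t *ᵥ (reflMatrix t *ᵥ ψ) = ψ := by
  funext b
  have h0 : (0 : ℝ) ≤ 1 - t b.2.1 ^ 2 := by
    have := (sq_le_one_iff_abs_le_one _).2 (ht b.2.1)
    linarith
  have hs : ((√(1 - t b.2.1 ^ 2) : ℝ) : ℂ) * ((√(1 - t b.2.1 ^ 2) : ℝ) : ℂ) =
      1 - (t b.2.1 : ℂ) ^ 2 := by
    rw [← Complex.ofReal_mul, Real.mul_self_sqrt h0]; push_cast; ring
  rw [reflMatrix_mulVec, reflMatrix_mulVec, reflMatrix_mulVec, Basis.flip_flip]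
  have h1 : b.flip.2.1 = b.2.1 := rfl
  have h2 : b.flip.2.2 0 = !b.2.2 0 := rfl
  rw [h1, h2]
  cases b.2.2 0 <;> push_cast <;> simp <;> linear_combination (ψ b) * hs

theorem reflMatrix_isHermitian (t : FixedPt c₁ c₂ → ℝ) :
    (reflMatrix t : Matrix (Basis d c₁ c₂ 1) _ ℂ)ᴴ = reflMatrix t := by
  ext b b'
  have e1 : (b = b') = (b' = b) := propext eq_comm
  have e2 : (b = b'.flip) = (b' = b.flip) := by
    refine propext ⟨fun h => ?_, fun h => ?_⟩ <;> rw [h, Basis.flip_flip]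
  simp only [Matrix.conjTranspose_apply, reflMatrix, e1, e2]
  by_cases h1 : b' = b
  · subst h1
    simp [(Basis.flip_ne b').symm]
  · by_cases h2 : b' = b.flip
    · subst h2
      have h3 : b.flip.2.1 = b.2.1 := rfl
      simp [Basis.flip_ne, h3]
    · simp [h1, h2]

theorem mem_unitaryGroup_of_involution {ι : Type*} [Fintype ι] [DecidableEq ι]
    {M : Matrix ι ι ℂ} (h : Mᴴ = M) (h2 : ∀ ψ, M *ᵥ (M *ᵥ ψ) = ψ) :
    M ∈ Matrix.unitaryGroup ι ℂ := by
  rw [Matrix.mem_unitaryGroup_iff', Matrix.star_eq_conjTranspose, h]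
  refine Matrix.mulVec_injective (funext fun ψ => ?_)
  rw [← Matrix.mulVec_mulVec, h2, Matrix.one_mulVec]

/-- The gate of `reflMatrix`. -/
def reflGate (t : FixedPt c₁ c₂ → ℝ) (ht : ∀ y, |t y| ≤ 1) :
    Matrix.unitaryGroup (Basis d c₁ c₂ 1) ℂ :=
  ⟨reflMatrix t, mem_unitaryGroup_of_involution (reflMatrix_isHermitian t)
    (reflMatrix_mulVec_mulVec ht)⟩

/-- The matrix of the reflection that fixes `|0⋯0⟩` and negates its orthogonal complement. -/
def zeroReflMatrix (d c₁ c₂ a : ℕ) : Matrix (Basis d c₁ c₂ a) (Basis d c₁ c₂ a) ℂ :=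
  Matrix.diagonal fun b => if b = Basis.zero then 1 else -1

theorem zeroReflMatrix_mulVec {a : ℕ} (ψ : Basis d c₁ c₂ a → ℂ) :
    zeroReflMatrix d c₁ c₂ a *ᵥ ψ =
      (2 * ψ Basis.zero) • (Pi.single Basis.zero 1 : Basis d c₁ c₂ a → ℂ) - ψ := by
  funext b
  rw [zeroReflMatrix, Matrix.mulVec_diagonal]
  by_cases h : b = Basis.zero
  · subst h; simp; ring
  · simp [h]

/-- The gate of `zeroReflMatrix`. -/
def zeroReflGate (d c₁ c₂ a : ℕ) : Matrix.unitaryGroup (Basis d c₁ c₂ a) ℂ :=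
  ⟨zeroReflMatrix d c₁ c₂ a, by
    refine mem_unitaryGroup_of_involution ?_ fun ψ => ?_
    · rw [zeroReflMatrix, Matrix.diagonal_conjTranspose]
      congr 1
      funext b
      by_cases h : b = Basis.zero <;> simp [h]
    · funext b
      rw [zeroReflMatrix, Matrix.mulVec_diagonal, Matrix.mulVec_diagonal]
      by_cases h : b = Basis.zero <;> simp [h]⟩

/-- The reflection about `|0⋯0⟩`, followed by the reflection `load† · query · reflGate · query ·
load`. -/
def walkStep (t : FixedPt c₁ c₂ → ℝ) (ht : ∀ y, |t y| ≤ 1) : Circuit d c₁ c₂ 1 :=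
  [.gate (zeroReflGate d c₁ c₂ 1), .load, .query, .gate (reflGate t ht), .query, .unload]

/-- `walkStep` repeated `M` times. -/
def walk (t : FixedPt c₁ c₂ → ℝ) (ht : ∀ y, |t y| ≤ 1) : ℕ → Circuit d c₁ c₂ 1
  | 0 => []
  | M + 1 => walk t ht M ++ walkStep t ht

theorem queries_walk (t : FixedPt c₁ c₂ → ℝ) (ht : ∀ y, |t y| ≤ 1) (M : ℕ) :
    (walk t ht M : Circuit d c₁ c₂ 1).queries = 2 * M := by
  induction M with
  | zero => simp [walk, Circuit.queries]
  | succ M ih =>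
    rw [Circuit.queries] at ih
    simp only [walk, walkStep, Circuit.queries, List.map_append, List.sum_append, ih,
      List.map_cons, List.map_nil, List.sum_cons, List.sum_nil, Step.queries]
    ring

/-- The self-inverse unitary `load† · query · reflMatrix t · query · load`. -/
def walkUnitary (O : Oracle d c₁ c₂) (t : FixedPt c₁ c₂ → ℝ) (ψ : Basis d c₁ c₂ 1 → ℂ) :
    Basis d c₁ c₂ 1 → ℂ :=
  Step.act O .unload (Step.act O .query (reflMatrix t *ᵥ
    (Step.act O .query (Step.act O .load ψ))))

theorem applyX_add {a : ℕ} (M : Matrix (XReg d c₁ c₂) (XReg d c₁ c₂) ℂ)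
    (ψ φ : Basis d c₁ c₂ a → ℂ) : applyX M (ψ + φ) = applyX M ψ + applyX M φ := by
  funext b; simp [applyX, mul_add, Finset.sum_add_distrib]

theorem applyX_smul {a : ℕ} (M : Matrix (XReg d c₁ c₂) (XReg d c₁ c₂) ℂ) (z : ℂ)
    (ψ : Basis d c₁ c₂ a → ℂ) : applyX M (z • ψ) = z • applyX M ψ := by
  funext b
  simp only [applyX, Pi.smul_apply, smul_eq_mul, Finset.mul_sum]
  exact Finset.sum_congr rfl fun x _ => by ring

theorem applyX_applyX {a : ℕ} {M N : Matrix (XReg d c₁ c₂) (XReg d c₁ c₂) ℂ} (h : M * N = 1)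
    (ψ : Basis d c₁ c₂ a → ℂ) : applyX M (applyX N ψ) = ψ := by
  funext b
  have := congrFun (congrArg (fun A => A *ᵥ fun x => ψ (x, b.2)) h) b.1
  rw [← Matrix.mulVec_mulVec, Matrix.one_mulVec] at this
  exact this

theorem query_query {a : ℕ} (O : Oracle d c₁ c₂) (ψ : Basis d c₁ c₂ a → ℂ) :
    Step.act O .query (Step.act O .query ψ) = ψ := by
  funext b
  simp only [Step.act, FixedPt.xor_xor_cancel_right]

theorem walkUnitary_add (O : Oracle d c₁ c₂) (t : FixedPt c₁ c₂ → ℝ)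
    (ψ φ : Basis d c₁ c₂ 1 → ℂ) :
    walkUnitary O t (ψ + φ) = walkUnitary O t ψ + walkUnitary O t φ := by
  have hq : ∀ ψ φ : Basis d c₁ c₂ 1 → ℂ, Step.act O .query (ψ + φ) =
    Step.act O .query ψ + Step.act O .query φ := fun _ _ => rfl
  simp only [walkUnitary, Step.act.eq_2, Step.act.eq_3, applyX_add, hq, Matrix.mulVec_add]

theorem walkUnitary_smul (O : Oracle d c₁ c₂) (t : FixedPt c₁ c₂ → ℝ) (z : ℂ)
    (ψ : Basis d c₁ c₂ 1 → ℂ) : walkUnitary O t (z • ψ) = z • walkUnitary O t ψ := by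
  have hq : ∀ ψ : Basis d c₁ c₂ 1 → ℂ, Step.act O .query (z • ψ) =
    z • Step.act O .query ψ := fun _ => rfl
  simp only [walkUnitary, Step.act.eq_2, Step.act.eq_3, applyX_smul, hq, Matrix.mulVec_smul]

theorem walkUnitary_walkUnitary (O : Oracle d c₁ c₂) {t : FixedPt c₁ c₂ → ℝ}
    (ht : ∀ y, |t y| ≤ 1) (ψ : Basis d c₁ c₂ 1 → ℂ) :
    walkUnitary O t (walkUnitary O t ψ) = ψ := by
  have h1 : ∀ ψ : Basis d c₁ c₂ 1 → ℂ, Step.act O .load (Step.act O .unload ψ) = ψ :=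
    applyX_applyX (Matrix.mem_unitaryGroup_iff.1 O.loader.2)
  have h2 : ∀ ψ : Basis d c₁ c₂ 1 → ℂ, Step.act O .unload (Step.act O .load ψ) = ψ :=
    applyX_applyX (Matrix.mem_unitaryGroup_iff'.1 O.loader.2)
  simp only [walkUnitary, h1, query_query, reflMatrix_mulVec_mulVec ht, h2]

/-- The first query writes `h x` into the zeroed output register, the reflection contributes its
diagonal entry `t (h x)` when the work qubit stays `0`, and the second query erases `h x`. Undoing
the loader then takes the inner product with the loaded state. -/
theorem walkUnitary_zero (O : Oracle d c₁ c₂) (t : FixedPt c₁ c₂ → ℝ) :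
    walkUnitary O t (Pi.single Basis.zero 1) Basis.zero =
      ((∑ x, ‖O.loader.1 x XReg.zero‖ ^ 2 * t (O.h x) : ℝ) : ℂ) := by
  set L : Matrix (XReg d c₁ c₂) (XReg d c₁ c₂) ℂ := O.loader.1 with hL
  have h1 : ∀ (x : XReg d c₁ c₂) (w : Fin 1 → Bool),
      Step.act O .load (Pi.single Basis.zero 1) (x, FixedPt.zero, w) =
        if w = fun _ => false then L x XReg.zero else 0 := by
    intro x w
    simp only [Step.act, applyX]
    by_cases hw : w = fun _ => false
    · subst hw
      rw [Finset.sum_eq_single XReg.zero]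
      · rw [if_pos rfl]
        change L x XReg.zero * (Pi.single Basis.zero 1 : Basis d c₁ c₂ 1 → ℂ) Basis.zero = _
        rw [Pi.single_eq_same, mul_one]
      · intro x' _ hx'
        rw [Pi.single_eq_of_ne, mul_zero]
        intro h
        exact hx' (congrArg (fun b : Basis d c₁ c₂ 1 => b.1) h)
      · simp
    · rw [if_neg hw]
      refine Finset.sum_eq_zero fun x' _ => ?_
      rw [Pi.single_eq_of_ne, mul_zero]
      intro h
      exact hw (congrArg (fun b : Basis d c₁ c₂ 1 => b.2.2) h)
  have h2 : ∀ x : XReg d c₁ c₂, Step.act O .query (reflMatrix t *ᵥ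
      (Step.act O .query (Step.act O .load (Pi.single Basis.zero 1)))) (x, FixedPt.zero,
        fun _ => false) = (t (O.h x) : ℂ) * L x XReg.zero := by
    intro x
    rw [Step.act.eq_4]
    simp only
    rw [reflMatrix_mulVec]
    simp only [Step.act.eq_4, Basis.flip, FixedPt.zero_xor, FixedPt.xor_self, h1]
    simp [funext_iff]
  rw [walkUnitary, Step.act.eq_3, applyX]
  change ∑ x, (O.loader.1ᴴ) XReg.zero x * Step.act O .query (reflMatrix t *ᵥ
    (Step.act O .query (Step.act O .load (Pi.single Basis.zero 1)))) (x, FixedPt.zero,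
      fun _ => false) = _
  simp only [h2]
  push_cast
  refine Finset.sum_congr rfl fun x _ => ?_
  rw [Matrix.conjTranspose_apply, ← Complex.conj_mul', ← hL]
  simp only [RCLike.star_def]
  ring

theorem state_walk_succ (O : Oracle d c₁ c₂) (t : FixedPt c₁ c₂ → ℝ) (ht : ∀ y, |t y| ≤ 1)
    (M : ℕ) : (walk t ht (M + 1)).state O =
      walkUnitary O t (zeroReflMatrix d c₁ c₂ 1 *ᵥ (walk t ht M).state O) := by
  rw [Circuit.state, walk, List.foldl_append]
  rfl

/-- The amplitude of `|0⋯0⟩` after `M` steps is the `M`-th Chebyshev polynomial, evaluated at the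
mean of `t`. -/
theorem state_walk_zero (O : Oracle d c₁ c₂) (t : FixedPt c₁ c₂ → ℝ) (ht : ∀ y, |t y| ≤ 1)
    {θ : ℝ} (hθ : ∑ x, ‖O.loader.1 x XReg.zero‖ ^ 2 * t (O.h x) = Real.cos θ)
    (M : ℕ) : (walk t ht M).state O Basis.zero = (Real.cos (M * θ) : ℝ) := by
  set e : Basis d c₁ c₂ 1 → ℂ := Pi.single Basis.zero 1 with he
  set s : ℂ := ((Real.cos θ : ℝ) : ℂ) with hs
  have hUe : walkUnitary O t e Basis.zero = s := by rw [he, walkUnitary_zero, hθ]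
  have he0 : e Basis.zero = 1 := Pi.single_eq_same _ _
  set T : (Basis d c₁ c₂ 1 → ℂ) → (Basis d c₁ c₂ 1 → ℂ) := fun ψ =>
    walkUnitary O t (zeroReflMatrix d c₁ c₂ 1 *ᵥ ψ) with hT
  have Tform : ∀ ψ, T ψ = (2 * ψ Basis.zero) • walkUnitary O t e - walkUnitary O t ψ := by
    intro ψ
    simp only [hT, zeroReflMatrix_mulVec, sub_eq_add_neg]
    rw [walkUnitary_add, walkUnitary_smul, ← neg_one_smul ℂ ψ, walkUnitary_smul, neg_one_smul]
  have T0 : T e = walkUnitary O t e := by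
    rw [Tform, he0]; module
  have T1 : T (walkUnitary O t e) = (2 * s) • walkUnitary O t e - e := by
    rw [Tform, hUe, walkUnitary_walkUnitary O ht]
  have Tlin : ∀ (z : ℂ) ψ φ, T (z • ψ - φ) = z • T ψ - T φ := by
    intro z ψ φ
    simp only [Tform, sub_eq_add_neg]
    rw [walkUnitary_add, walkUnitary_smul, ← neg_one_smul ℂ φ, walkUnitary_smul]
    simp only [Pi.add_apply, Pi.smul_apply, smul_eq_mul]
    module
  have hst : ∀ M, (walk t ht (M + 1)).state O = T ((walk t ht M).state O) :=
    fun M => state_walk_succ O t ht M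
  have hst0 : (walk t ht 0).state O = e := rfl
  -- The first instance uses that the walk unitary is self-inverse; linearity of `T` carries the
  -- relation to all later steps.
  have rec2 : ∀ M, (walk t ht (M + 2)).state O =
      (2 * s) • (walk t ht (M + 1)).state O - (walk t ht M).state O := by
    intro M
    induction M with
    | zero => rw [hst, hst, hst0, T0, T1]
    | succ M ih =>
      rw [hst (M + 2), ih, Tlin, ← hst, ← hst, ← ih]
  induction M using Nat.twoStepInduction with
  | zero => simp [hst0, he0]
  | one => rw [hst, hst0, T0, hUe]; simp [hs]
  | more M ih1 ih2 =>
    rw [rec2, Pi.sub_apply, Pi.smul_apply, ih1, ih2, hs, smul_eq_mul]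
    have h1 : ((M + 2 : ℕ) : ℝ) * θ = ((M + 1 : ℕ) : ℝ) * θ + θ := by push_cast; ring
    have h2 : (M : ℝ) * θ = ((M + 1 : ℕ) : ℝ) * θ - θ := by push_cast; ring
    rw [h1, h2, Real.cos_add, Real.cos_sub]
    push_cast
    ring

end ForwardGradient

namespace ForwardGradient

variable {d c₁ c₂ : ℕ}

/-! ### One refinement stage -/

/-- The number of walk steps for an interval of half-width `r`. -/
def stageReps (r : ℝ) : ℕ := 2 * ⌈r⁻¹⌉₊

/-- The angle that corresponds to the centre of an interval of half-width `r`. -/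
def stageAngle (r : ℝ) : ℝ := Real.pi / (4 * stageReps r)

/-- The amplitude that encodes the number `y / B`, relative to the centre `c` of an interval of
half-width `r`. -/
def stageFun (B r c : ℝ) (y : FixedPt c₁ c₂) : ℝ :=
  max (-1) (min 1 (Real.sin (stageAngle r) + (y.value / B - c) / 16))

theorem abs_stageFun_le (B r c : ℝ) (y : FixedPt c₁ c₂) : |stageFun B r c y| ≤ 1 :=
  abs_le.2 ⟨le_max_left _ _, max_le (by norm_num) (min_le_left _ _)⟩

theorem two_div_le_stageReps (r : ℝ) : 2 / r ≤ stageReps r := by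
  have := Nat.le_ceil r⁻¹
  rw [stageReps]
  push_cast
  rw [div_eq_mul_inv]
  linarith

theorem stageReps_le {r : ℝ} (hr : 0 < r) (hr1 : r ≤ 1) : (stageReps r : ℝ) ≤ 4 / r := by
  have h1 := Nat.ceil_lt_add_one (inv_nonneg.2 hr.le)
  have h2 : 1 ≤ r⁻¹ := (one_le_inv₀ hr).2 hr1
  rw [stageReps]
  push_cast
  rw [div_eq_mul_inv]
  linarith

theorem two_le_stageReps {r : ℝ} (hr : 0 < r) (hr1 : r ≤ 1) : (2 : ℝ) ≤ stageReps r :=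
  le_trans ((le_div_iff₀ hr).2 (by linarith)) (two_div_le_stageReps r)

theorem stageAngle_pos {r : ℝ} (hr : 0 < r) (hr1 : r ≤ 1) : 0 < stageAngle r := by
  have := two_le_stageReps hr hr1
  unfold stageAngle
  have := Real.pi_pos
  positivity

theorem stageAngle_le {r : ℝ} (hr : 0 < r) (hr1 : r ≤ 1) : stageAngle r ≤ Real.pi / 8 := by
  have := two_le_stageReps hr hr1
  unfold stageAngle
  have := Real.pi_pos
  gcongr
  linarith

theorem stageReps_mul_stageAngle {r : ℝ} (hr : 0 < r) (hr1 : r ≤ 1) :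
    2 * stageReps r * stageAngle r = Real.pi / 2 := by
  have := two_le_stageReps hr hr1
  unfold stageAngle
  field_simp
  norm_num

/-- Guarantees that every shifted mean in the current interval has its arcsine between `0` and twice
the stage angle, so that multiplying by `2 * stageReps r` lands in `[0, π]`, where cosine is
monotone. -/
theorem stage_margin {r : ℝ} (hr : 0 < r) (hr1 : r ≤ 1) :
    r / 16 ≤ Real.sin (stageAngle r) ∧
      Real.sin (stageAngle r) + r / 16 ≤ Real.sin (2 * stageAngle r) := by
  set b := stageAngle r with hb
  have hM := two_le_stageReps hr hr1
  have hb0 : 0 < b := stageAngle_pos hr hr1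
  have hb1 : b ≤ Real.pi / 8 := stageAngle_le hr hr1
  have hpi := Real.pi_pos
  have hpi4 := Real.pi_le_four
  have h1 : r / 8 ≤ Real.sin b := by
    have h := Real.mul_le_sin hb0.le (by linarith)
    refine le_trans ?_ h
    have : 2 / Real.pi * b = 1 / (2 * stageReps r) := by
      rw [hb, stageAngle]; field_simp; norm_num
    rw [this, le_div_iff₀ (by positivity)]
    have := stageReps_le hr hr1
    rw [le_div_iff₀ hr] at this
    linarith
  -- This makes `sin (2 * b)` at least `3 / 2 * sin b`, and half of `sin b ≥ r / 8` is the required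
  -- margin.
  have h2 : 3 / 4 ≤ Real.cos b := by
    have := Real.one_sub_sq_div_two_le_cos (x := b)
    nlinarith
  refine ⟨by linarith, ?_⟩
  rw [Real.sin_two_mul]
  nlinarith

theorem one_div_twenty_le_sin : (1 : ℝ) / 20 ≤ Real.sin (1 / 12) := by
  have h := Real.mul_le_sin (x := 1 / 12) (by norm_num) (by linarith [Real.pi_gt_three])
  refine le_trans ?_ h
  rw [div_mul_eq_mul_div, le_div_iff₀ Real.pi_pos]
  linarith [Real.pi_lt_d2]

/-- The number of walk steps is even, so passing from arccosine to arcsine shifts the doubled angle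
by a multiple of `2π`. -/
theorem cos_sq_stageReps_mul_arccos (r s : ℝ) :
    Real.cos (stageReps r * Real.arccos s) ^ 2 =
      1 / 2 + Real.cos (2 * stageReps r * Real.arcsin s) / 2 := by
  rw [Real.cos_sq, Real.arccos]
  congr 2
  have : 2 * (stageReps r * (Real.pi / 2 - Real.arcsin s)) =
      (⌈r⁻¹⌉₊ : ℕ) * (2 * Real.pi) - 2 * stageReps r * Real.arcsin s := by
    rw [stageReps]; push_cast; ring
  rw [this, Real.cos_nat_mul_two_pi_sub]

/-- At the stage angle the doubled phase is `π / 2`. Since sine is 1-Lipschitz, an excess of `r /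
48` in `s` moves the arcsine by at least as much, and the factor `2 * stageReps r ≥ 4 / r` amplifies
it to `1 / 12`. The probability then drops by at least half of `sin (1 / 12) ≥ 1 / 20`. -/
theorem stage_prob_le {r s : ℝ} (hr : 0 < r) (hr1 : r ≤ 1)
    (h1 : Real.sin (stageAngle r) + r / 48 ≤ s) (h2 : s ≤ Real.sin (stageAngle r) + r / 16) :
    Real.cos (stageReps r * Real.arccos s) ^ 2 ≤ 19 / 40 := by
  obtain ⟨-, hm⟩ := stage_margin hr hr1
  have hMb := stageReps_mul_stageAngle hr hr1
  have hMr := (div_le_iff₀ hr).1 (two_div_le_stageReps r)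
  have hM := two_le_stageReps hr hr1
  have hb0 := stageAngle_pos hr hr1
  have hb1 := stageAngle_le hr hr1
  set b := stageAngle r
  set M : ℝ := (stageReps r : ℝ)
  have hpi := Real.pi_pos
  have ha1 : Real.arcsin s ≤ 2 * b :=
    (Real.arcsin_le_iff_le_sin' ⟨by linarith, by linarith⟩).2 (by linarith)
  have hs1 : s ≤ 1 := by linarith [Real.sin_le_one (2 * b)]
  have hs0 : -1 ≤ s := by linarith [Real.neg_one_le_sin b]
  have hba : b ≤ Real.arcsin s :=
    (Real.le_arcsin_iff_sin_le' ⟨by linarith, by linarith⟩).2 (by linarith)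
  have hlip : Real.sin (Real.arcsin s) - Real.sin b ≤ Real.arcsin s - b := by
    have := Real.abs_sin_sub_sin_le (Real.arcsin s) b
    rw [abs_of_nonneg (sub_nonneg.2 hba)] at this
    exact (le_abs_self _).trans this
  rw [Real.sin_arcsin hs0 hs1] at hlip
  have hlow : Real.pi / 2 + 1 / 12 ≤ 2 * M * Real.arcsin s := by nlinarith
  have hup : 2 * M * Real.arcsin s ≤ Real.pi := by nlinarith
  rw [cos_sq_stageReps_mul_arccos]
  have := Real.cos_le_cos_of_nonneg_of_le_pi (by linarith) hup hlow
  rw [add_comm, Real.cos_add_pi_div_two] at this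
  linarith [one_div_twenty_le_sin]

theorem le_stage_prob {r s : ℝ} (hr : 0 < r) (hr1 : r ≤ 1)
    (h1 : Real.sin (stageAngle r) - r / 16 ≤ s) (h2 : s ≤ Real.sin (stageAngle r) - r / 48) :
    21 / 40 ≤ Real.cos (stageReps r * Real.arccos s) ^ 2 := by
  obtain ⟨hm, -⟩ := stage_margin hr hr1
  have hMb := stageReps_mul_stageAngle hr hr1
  have hMr := (div_le_iff₀ hr).1 (two_div_le_stageReps r)
  have hM := two_le_stageReps hr hr1
  have hb0 := stageAngle_pos hr hr1
  have hb1 := stageAngle_le hr hr1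
  set b := stageAngle r
  set M : ℝ := (stageReps r : ℝ)
  have hpi := Real.pi_pos
  have ha0 : 0 ≤ Real.arcsin s := Real.arcsin_nonneg.2 (by linarith)
  have hs1 : s ≤ 1 := by linarith [Real.sin_le_one b]
  have hs0 : -1 ≤ s := by linarith
  have hba : Real.arcsin s ≤ b :=
    (Real.arcsin_le_iff_le_sin' ⟨by linarith, by linarith⟩).2 (by linarith)
  have hlip : Real.sin b - Real.sin (Real.arcsin s) ≤ b - Real.arcsin s := by
    have := Real.abs_sin_sub_sin_le b (Real.arcsin s)
    rw [abs_of_nonneg (sub_nonneg.2 hba)] at this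
    exact (le_abs_self _).trans this
  rw [Real.sin_arcsin hs0 hs1] at hlip
  have hup : 2 * M * Real.arcsin s ≤ Real.pi / 2 - 1 / 12 := by nlinarith
  rw [cos_sq_stageReps_mul_arccos]
  have := Real.cos_le_cos_of_nonneg_of_le_pi (mul_nonneg (by linarith) ha0)
    (by linarith : Real.pi / 2 - 1 / 12 ≤ Real.pi) hup
  rw [Real.cos_pi_div_two_sub] at this
  linarith [one_div_twenty_le_sin]

/-- The clamp in `stageFun` only makes the gate unitary for arbitrary bit strings. On the support it
is inactive: the sine is at most `π / 8` and the shift at most `2 / 16`. So the mean is affine in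
the mean sought. -/
theorem weighted_mean_stageFun (O : Oracle d c₁ c₂) {B r c : ℝ} (hr : 0 < r) (hr1 : r ≤ 1)
    (hc : |c| ≤ 1) (hsum : ∑ x, ‖O.loader.1 x XReg.zero‖ ^ 2 = 1)
    (hO : ∀ x, O.loader.1 x XReg.zero ≠ 0 → |(O.h x).value / B| ≤ 1) :
    ∑ x, ‖O.loader.1 x XReg.zero‖ ^ 2 * stageFun B r c (O.h x) = Real.sin (stageAngle r) +
      (∑ x, ‖O.loader.1 x XReg.zero‖ ^ 2 * ((O.h x).value / B) - c) / 16 := by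
  have hb0 := stageAngle_pos hr hr1
  have hb1 := stageAngle_le hr hr1
  have hs0 := Real.sin_nonneg_of_nonneg_of_le_pi hb0.le (by linarith [Real.pi_pos])
  have hs1 := (Real.sin_lt hb0).le
  have hpi4 := Real.pi_le_four
  have h : ∀ x, ‖O.loader.1 x XReg.zero‖ ^ 2 * stageFun B r c (O.h x) =
      ‖O.loader.1 x XReg.zero‖ ^ 2 * (Real.sin (stageAngle r) - c / 16) +
        ‖O.loader.1 x XReg.zero‖ ^ 2 * ((O.h x).value / B) / 16 := by
    intro x
    by_cases hx : O.loader.1 x XReg.zero = 0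
    · simp [hx]
    · have := abs_le.1 (hO x hx)
      have hc' := abs_le.1 hc
      rw [stageFun, min_eq_right (by linarith), max_eq_right (by linarith)]
      ring
  rw [Finset.sum_congr rfl fun x _ => h x, Finset.sum_add_distrib, ← Finset.sum_mul, hsum,
    ← Finset.sum_div]
  ring

theorem norm_sq_state_walk_stage (O : Oracle d c₁ c₂) {B r c : ℝ} (hr : 0 < r) (hr1 : r ≤ 1)
    (hc : |c| ≤ 1) (hsum : ∑ x, ‖O.loader.1 x XReg.zero‖ ^ 2 = 1)
    (hO : ∀ x, O.loader.1 x XReg.zero ≠ 0 → |(O.h x).value / B| ≤ 1) (M : ℕ) :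
    ‖(walk (stageFun B r c) (abs_stageFun_le B r c) M).state O Basis.zero‖ ^ 2 =
      Real.cos (M * Real.arccos (Real.sin (stageAngle r) +
        (∑ x, ‖O.loader.1 x XReg.zero‖ ^ 2 * ((O.h x).value / B) - c) / 16)) ^ 2 := by
  have hmean := weighted_mean_stageFun O hr hr1 hc hsum hO
  have habs : |∑ x, ‖O.loader.1 x XReg.zero‖ ^ 2 * stageFun B r c (O.h x)| ≤ 1 := by
    refine (Finset.abs_sum_le_sum_abs _ _).trans ?_
    rw [← hsum]
    refine Finset.sum_le_sum fun x _ => ?_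
    rw [abs_mul, abs_of_nonneg (sq_nonneg _)]
    exact mul_le_of_le_one_right (sq_nonneg _) (abs_stageFun_le _ _ _ _)
  rw [state_walk_zero O _ _ (Real.cos_arccos (abs_le.1 habs).1 (abs_le.1 habs).2).symm, hmean,
    Complex.norm_real, Real.norm_eq_abs, sq_abs]

/-! ### Tail bounds for the majority vote -/

/-- Chernoff bound with tilt `20 / 19`: at `q = 19 / 40` each sample contributes the factor
`0.99875`, below `1 - 1 / 1000`. -/
theorem vote_pow_le {q : ℝ} (hq0 : 0 ≤ q) (hq : q ≤ 19 / 40) (N : ℕ) :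
    (19 / 20 : ℝ) ^ N * (1 + q * (((19 / 20 : ℝ)⁻¹) ^ 2 - 1)) ^ N ≤ Real.exp (-(N / 1000)) := by
  have h1 : (1 : ℝ) - 1 / 1000 ≤ Real.exp (-(1 / 1000)) := by
    linarith [Real.add_one_le_exp (-(1 / 1000) : ℝ)]
  have h2 : Real.exp (-(N / 1000 : ℝ)) = Real.exp (-(1 / 1000)) ^ N := by
    rw [← Real.exp_nat_mul]; ring_nf
  rw [← mul_pow, h2]
  refine pow_le_pow_left₀ (by norm_num; nlinarith) (le_trans ?_ h1) N
  norm_num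
  linarith

theorem vote_pow_le' {q : ℝ} (hq0 : q ≤ 1) (hq : 21 / 40 ≤ q) (N : ℕ) :
    ((19 / 20 : ℝ)⁻¹) ^ N * (1 + q * ((19 / 20 : ℝ) ^ 2 - 1)) ^ N ≤
      Real.exp (-(N / 1000)) := by
  have h1 : (1 : ℝ) - 1 / 1000 ≤ Real.exp (-(1 / 1000)) := by
    linarith [Real.add_one_le_exp (-(1 / 1000) : ℝ)]
  have h2 : Real.exp (-(N / 1000 : ℝ)) = Real.exp (-(1 / 1000)) ^ N := by
    rw [← Real.exp_nat_mul]; ring_nf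
  rw [← mul_pow, h2]
  refine pow_le_pow_left₀ (by norm_num; nlinarith) (le_trans ?_ h1) N
  norm_num
  linarith

/-! ### Iterated refinement -/

/-- Refine an estimate of a mean: the mean divided by `B` is known to lie within `r` of `c`; each
stage shrinks `r` by the factor `2 / 3`. -/
def QAlgorithm.refine (B : ℝ) (N₀ : ℕ) : ℕ → ℝ → ℝ → QAlgorithm d c₁ c₂
  | 0, _, c => .ret (c * B)
  | i + 1, r, c =>
    .count (walk (stageFun B r c) (abs_stageFun_le B r c) (stageReps r))
      (fun s => if N₀ + 1000 * (i + 1) ≤ 2 * s then refine B N₀ i (2 / 3 * r) (c - r / 3)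
        else refine B N₀ i (2 / 3 * r) (c + r / 3)) (N₀ + 1000 * (i + 1)) 0

/-- The numerator solves the recursion `a (i + 1) = 8 * (N₀ + 1000 * (i + 1)) + 3 / 2 * a i`
exactly. Because the extra votes decrease with the number of stages left, the expensive late stages
need few of them and no factor for the number of stages appears. -/
theorem QAlgorithm.queries_refine_le (B : ℝ) (N₀ i : ℕ) {r : ℝ} (hr : 0 < r) (hr1 : r ≤ 1)
    (c : ℝ) : ((QAlgorithm.refine B N₀ i r c : QAlgorithm d c₁ c₂).queries : ℝ) ≤
      ((16 * N₀ + 48000) * ((3 / 2) ^ i - 1) - 16000 * i) / r := by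
  induction i generalizing r c with
  | zero => simp [QAlgorithm.refine, QAlgorithm.queries]
  | succ i ih =>
    set R : ℝ := ((16 * N₀ + 48000) * ((3 / 2) ^ i - 1) - 16000 * i) / (2 / 3 * r) with hR
    have hle : ∀ c', ((QAlgorithm.refine B N₀ i (2 / 3 * r) c' :
        QAlgorithm d c₁ c₂).queries : ℝ) ≤ R := fun c' => ih (by linarith) (by linarith) c'
    have hR0 : 0 ≤ R := (Nat.cast_nonneg _).trans (hle 0)
    have h := QAlgorithm.queries_count_le
      (walk (stageFun B r c) (abs_stageFun_le B r c) (stageReps r))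
      (fun s => if N₀ + 1000 * (i + 1) ≤ 2 * s then
        (refine B N₀ i (2 / 3 * r) (c - r / 3) : QAlgorithm d c₁ c₂)
        else refine B N₀ i (2 / 3 * r) (c + r / 3)) (B := ⌊R⌋₊)
      (fun s => by
        refine Nat.le_floor ?_
        split_ifs <;> exact hle _)
      (N₀ + 1000 * (i + 1)) 0
    rw [queries_walk] at h
    have h' : ((QAlgorithm.refine B N₀ (i + 1) r c : QAlgorithm d c₁ c₂).queries : ℝ) ≤
        (N₀ + 1000 * (i + 1)) * (2 * stageReps r) + R := by
      refine le_trans (Nat.cast_le.2 h) ?_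
      push_cast
      gcongr
      exact Nat.floor_le hR0
    refine h'.trans ?_
    have hM := stageReps_le hr hr1
    calc (N₀ + 1000 * ((i : ℝ) + 1)) * (2 * stageReps r) + R
        ≤ (N₀ + 1000 * ((i : ℝ) + 1)) * (2 * (4 / r)) + R := by gcongr
      _ = ((16 * N₀ + 48000) * ((3 / 2) ^ (i + 1) - 1) - 16000 * ((i + 1 : ℕ) : ℝ)) / r := by
        rw [hR]
        push_cast
        field_simp
        ring

/-- A stage with `i + 1` stages left errs with probability at most `δ / 2 ^ (i + 1)`; these sum to
the stated geometric bound. If no stage errs, the mean stays in the shrinking interval. -/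
theorem QAlgorithm.prob_refine_le (O : Oracle d c₁ c₂) {B δ η : ℝ} (hB : 0 ≤ B) {N₀ : ℕ}
    (hδ : Real.exp (-(N₀ / 1000)) ≤ δ) (hsum : ∑ x, ‖O.loader.1 x XReg.zero‖ ^ 2 = 1)
    (hO : ∀ x, O.loader.1 x XReg.zero ≠ 0 → |(O.h x).value / B| ≤ 1) {μ : ℝ}
    (hμ : ∑ x, ‖O.loader.1 x XReg.zero‖ ^ 2 * ((O.h x).value / B) = μ) (i : ℕ) {r c : ℝ}
    (hr : 0 < r) (hc0 : -1 ≤ c - r) (hc1 : c + r ≤ 1) (hμr : |μ - c| ≤ r)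
    (hη : (2 / 3) ^ i * r * B ≤ η) :
    (QAlgorithm.refine B N₀ i r c).prob O {w | |w - μ * B| ≤ η}ᶜ ≤ δ * (1 - (1 / 2) ^ i) := by
  induction i generalizing r c with
  | zero =>
    have : c * B ∈ {w | |w - μ * B| ≤ η} := by
      rw [Set.mem_ofPred_eq, ← sub_mul, abs_mul, abs_of_nonneg hB, abs_sub_comm]
      exact (mul_le_mul_of_nonneg_right hμr hB).trans (by simpa using hη)
    simp only [refine, prob, pow_zero, sub_self, mul_zero]
    rw [Set.indicator_of_notMem (by simpa using this)]
  | succ i ih =>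
    set S : Set ℝ := {w | |w - μ * B| ≤ η}ᶜ with hS
    obtain ⟨hμ0, hμ1⟩ := abs_le.1 hμr
    have hr1 : r ≤ 1 := by linarith
    have hδ0 : 0 ≤ δ := (Real.exp_pos _).le.trans hδ
    have hη' : (2 / 3 : ℝ) ^ i * (2 / 3 * r) * B ≤ η := by
      refine le_trans (le_of_eq ?_) hη; ring
    obtain ⟨N, hN⟩ : ∃ N : ℕ, N = N₀ + 1000 * (i + 1) := ⟨_, rfl⟩
    set b₀ : ℝ := δ * (1 - (1 / 2) ^ i) with hb₀
    have hb₀0 : 0 ≤ b₀ := mul_nonneg hδ0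
      (sub_nonneg.2 (pow_le_one₀ (by norm_num) (by norm_num)))
    have htail : Real.exp (-(N / 1000)) ≤ δ * (1 / 2) ^ (i + 1) := by
      have h1 : -((N : ℝ) / 1000) = -(N₀ / 1000) + (i + 1 : ℕ) * (-1) := by
        rw [hN]; push_cast; ring
      rw [h1, Real.exp_add, Real.exp_nat_mul]
      gcongr
      rw [Real.exp_neg, one_div]
      have := Real.add_one_le_exp (1 : ℝ)
      gcongr
      linarith
    have hsplit : δ * (1 - (1 / 2) ^ (i + 1)) = b₀ + δ * (1 / 2) ^ (i + 1) := by
      rw [hb₀, pow_succ]; ring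
    rw [hsplit]
    have hlo : μ ≤ c + r / 3 →
        (QAlgorithm.refine B N₀ i (2 / 3 * r) (c - r / 3)).prob O S ≤ b₀ := fun h =>
      ih (by linarith) (by linarith) (by linarith) (abs_le.2 ⟨by linarith, by linarith⟩) hη'
    have hhi : c - r / 3 ≤ μ →
        (QAlgorithm.refine B N₀ i (2 / 3 * r) (c + r / 3)).prob O S ≤ b₀ := fun h =>
      ih (by linarith) (by linarith) (by linarith) (abs_le.2 ⟨by linarith, by linarith⟩) hη'
    set next : ℕ → QAlgorithm d c₁ c₂ := fun s =>
      if N ≤ 2 * s then refine B N₀ i (2 / 3 * r) (c - r / 3)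
        else refine B N₀ i (2 / 3 * r) (c + r / 3) with hnext
    set K := (walk (stageFun B r c) (abs_stageFun_le B r c) (stageReps r) :
      Circuit d c₁ c₂ 1) with hK
    have hcount : QAlgorithm.refine B N₀ (i + 1) r c = QAlgorithm.count K next N 0 := by
      subst hN; rfl
    rw [hcount]
    have hq := norm_sq_state_walk_stage O (B := B) hr hr1 (c := c)
      (abs_le.2 ⟨by linarith, by linarith⟩) hsum hO (stageReps r)
    rw [hμ, ← hK] at hq
    have hq1 : ‖K.state O Basis.zero‖ ^ 2 ≤ 1 := by
      rw [hq]; exact Real.cos_sq_le_one _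
    rcases le_or_gt (c + r / 3) μ with hcase | hcase
    · have hq2 := stage_prob_le (s := Real.sin (stageAngle r) + (μ - c) / 16) hr hr1
        (by linarith) (by linarith)
      rw [← hq] at hq2
      refine (QAlgorithm.prob_count_le O S K next (b₀ := b₀) (A := (19 / 20) ^ N)
        (x := ((19 / 20 : ℝ)⁻¹) ^ 2) (fun s => ?_) N 0).trans ?_
      · simp only [hnext]
        split_ifs with h
        · refine (QAlgorithm.prob_le_one O S _).trans ?_
          -- The vote is wrong here, and `N ≤ 2 * s` makes the tilted weight at least `1`, which
          -- dominates any failure probability.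
          have : (1 : ℝ) ≤ (19 / 20) ^ N * (((19 / 20 : ℝ)⁻¹) ^ 2) ^ s := by
            rw [← pow_mul, inv_pow, ← div_eq_mul_inv, one_le_div (by positivity)]
            exact pow_le_pow_of_le_one (by norm_num) (by norm_num) h
          linarith
        · have := hhi (by linarith)
          have h2 : (0 : ℝ) ≤ (19 / 20) ^ N * (((19 / 20 : ℝ)⁻¹) ^ 2) ^ s := by positivity
          linarith
      · rw [pow_zero, mul_one]
        linarith [vote_pow_le (sq_nonneg ‖K.state O Basis.zero‖) hq2 N]
    rcases le_or_gt μ (c - r / 3) with hcase' | hcase'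
    · have hq2 := le_stage_prob (s := Real.sin (stageAngle r) + (μ - c) / 16) hr hr1
        (by linarith) (by linarith)
      rw [← hq] at hq2
      refine (QAlgorithm.prob_count_le O S K next (b₀ := b₀) (A := ((19 / 20 : ℝ)⁻¹) ^ N)
        (x := (19 / 20 : ℝ) ^ 2) (fun s => ?_) N 0).trans ?_
      · simp only [hnext]
        split_ifs with h
        · have := hlo (by linarith)
          have h2 : (0 : ℝ) ≤ ((19 / 20 : ℝ)⁻¹) ^ N * ((19 / 20 : ℝ) ^ 2) ^ s := by positivity
          linarith
        · refine (QAlgorithm.prob_le_one O S _).trans ?_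
          have : (1 : ℝ) ≤ ((19 / 20 : ℝ)⁻¹) ^ N * ((19 / 20 : ℝ) ^ 2) ^ s := by
            rw [← pow_mul, inv_pow, mul_comm, ← div_eq_mul_inv, one_le_div (by positivity)]
            exact pow_le_pow_of_le_one (by norm_num) (by norm_num) (by omega)
          linarith
      · rw [pow_zero, mul_one]
        linarith [vote_pow_le' hq1 hq2 N]
    -- In the middle third both new intervals contain the mean, so the vote costs nothing.
    · refine (QAlgorithm.prob_count_le O S K next (b₀ := b₀) (A := 0)
        (x := 1) (fun s => ?_) N 0).trans ?_
      · simp only [hnext, zero_mul, add_zero]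
        split_ifs with h
        · exact hlo hcase.le
        · exact hhi hcase'.le
      · have : 0 ≤ δ * (1 / 2) ^ (i + 1) := by positivity
        simpa using this

end ForwardGradient

namespace ForwardGradient

/-! ### Fourth moments of sums of independent variables -/

section FourthMoment

variable {Ω : Type*} [MeasurableSpace Ω] {ν : Measure Ω} [IsProbabilityMeasure ν]

theorem integrable_pow_of_integrable_pow_four {f : Ω → ℝ} (hf : AEStronglyMeasurable f ν)
    (h4 : Integrable (fun x => f x ^ 4) ν) {j : ℕ} (hj : j ≤ 4) :
    Integrable (fun x => f x ^ j) ν := by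
  refine Integrable.mono' ((integrable_const (1 : ℝ)).add h4) (hf.pow j)
    (Filter.Eventually.of_forall fun x => ?_)
  rw [Real.norm_eq_abs, abs_pow]
  have h : f x ^ 4 = |f x| ^ 4 := (Even.pow_abs (by decide) _).symm
  simp only [Pi.add_apply, h]
  have h0 := abs_nonneg (f x)
  rcases le_total |f x| 1 with h1 | h1
  · have := pow_le_one₀ (n := j) h0 h1
    have : 0 ≤ |f x| ^ 4 := by positivity
    linarith
  · have := pow_le_pow_right₀ h1 hj
    linarith

theorem sq_integral_sq_le {f : Ω → ℝ} (hf : AEStronglyMeasurable f ν)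
    (h4 : Integrable (fun x => f x ^ 4) ν) : (∫ x, f x ^ 2 ∂ν) ^ 2 ≤ ∫ x, f x ^ 4 ∂ν := by
  set a := ∫ x, f x ^ 2 ∂ν with ha
  have h2 := integrable_pow_of_integrable_pow_four hf h4 (j := 2) (by norm_num)
  have h : 0 ≤ ∫ x, (f x ^ 2 - a) ^ 2 ∂ν := integral_nonneg fun x => sq_nonneg _
  have e : ∀ x, (f x ^ 2 - a) ^ 2 = f x ^ 4 + -2 * a * f x ^ 2 + a ^ 2 := fun x => by ring
  simp only [e] at h
  rw [integral_add (h4.fun_add (h2.const_mul _)) (integrable_const _),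
    integral_add h4 (h2.const_mul _), integral_const_mul, ← ha] at h
  simp only [integral_const, probReal_univ, smul_eq_mul, one_mul] at h
  nlinarith

/-- The four claims are proved by a joint induction: in the binomial expansion every term with a
first power vanishes by independence and centring, and the fourth moment step needs the second
moment. -/
theorem moments_sum_pi {f : Ω → ℝ} (hf : Measurable f) (h4 : Integrable (fun x => f x ^ 4) ν)
    (h0 : ∫ x, f x ∂ν = 0) (m : ℕ) :
    Integrable (fun v : Fin m → Ω => (∑ i, f (v i)) ^ 4) (Measure.pi fun _ => ν) ∧
    ∫ v : Fin m → Ω, ∑ i, f (v i) ∂(Measure.pi fun _ => ν) = 0 ∧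
    ∫ v : Fin m → Ω, (∑ i, f (v i)) ^ 2 ∂(Measure.pi fun _ => ν) = m * ∫ x, f x ^ 2 ∂ν ∧
    ∫ v : Fin m → Ω, (∑ i, f (v i)) ^ 4 ∂(Measure.pi fun _ => ν) ≤
      3 * (m : ℝ) ^ 2 * ∫ x, f x ^ 4 ∂ν := by
  induction m with
  | zero => simp
  | succ m ih =>
    obtain ⟨i4, i1, i2, i3⟩ := ih
    set π : Measure (Fin m → Ω) := Measure.pi fun _ => ν with hπ
    set S : (Fin m → Ω) → ℝ := fun v => ∑ i, f (v i) with hS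
    have hSm : Measurable S :=
      Finset.measurable_sum _ fun i _ => hf.comp (measurable_pi_apply i)
    have hmp := measurePreserving_piFinSuccAbove (fun _ : Fin (m + 1) => ν) 0
    have hsum : ∀ v : Fin (m + 1) → Ω, ∑ i, f (v i) =
        f (MeasurableEquiv.piFinSuccAbove (fun _ => Ω) 0 v).1 +
          S (MeasurableEquiv.piFinSuccAbove (fun _ => Ω) 0 v).2 := by
      intro v
      rw [Fin.sum_univ_succ]
      rfl
    have hint : ∀ G : Ω × (Fin m → Ω) → ℝ, ∫ v : Fin (m + 1) → Ω,
        G (MeasurableEquiv.piFinSuccAbove (fun _ => Ω) 0 v) ∂(Measure.pi fun _ => ν) =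
          ∫ z, G z ∂(ν.prod π) := fun G => hmp.integral_comp' G
    have hf' : ∀ j ≤ 4, Integrable (fun x => f x ^ j) ν := fun j hj =>
      integrable_pow_of_integrable_pow_four hf.aestronglyMeasurable h4 hj
    have hS' : ∀ j ≤ 4, Integrable (fun x => S x ^ j) π := fun j hj =>
      integrable_pow_of_integrable_pow_four hSm.aestronglyMeasurable i4 hj
    have hI : ∀ j ≤ 4, ∀ l ≤ 4, Integrable (fun z : Ω × (Fin m → Ω) => f z.1 ^ j * S z.2 ^ l)
        (ν.prod π) := fun j hj l hl => (hf' j hj).mul_prod (hS' l hl)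
    have hE : ∀ j l, ∫ z : Ω × (Fin m → Ω), f z.1 ^ j * S z.2 ^ l ∂(ν.prod π) =
        (∫ x, f x ^ j ∂ν) * ∫ w, S w ^ l ∂π := fun j l =>
      integral_prod_mul (fun x => f x ^ j) fun w => S w ^ l
    have e1 : (fun z : Ω × (Fin m → Ω) => f z.1 + S z.2) =
        fun z => f z.1 ^ 1 * S z.2 ^ 0 + f z.1 ^ 0 * S z.2 ^ 1 := by funext z; ring
    have e2 : (fun z : Ω × (Fin m → Ω) => (f z.1 + S z.2) ^ 2) =
        fun z => f z.1 ^ 2 * S z.2 ^ 0 + 2 * (f z.1 ^ 1 * S z.2 ^ 1) +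
          f z.1 ^ 0 * S z.2 ^ 2 := by funext z; ring
    have e4 : (fun z : Ω × (Fin m → Ω) => (f z.1 + S z.2) ^ 4) =
        fun z => f z.1 ^ 4 * S z.2 ^ 0 + 4 * (f z.1 ^ 3 * S z.2 ^ 1) +
          6 * (f z.1 ^ 2 * S z.2 ^ 2) + 4 * (f z.1 ^ 1 * S z.2 ^ 3) +
          f z.1 ^ 0 * S z.2 ^ 4 := by funext z; ring
    have I4 : Integrable (fun z : Ω × (Fin m → Ω) => (f z.1 + S z.2) ^ 4) (ν.prod π) := by
      rw [e4]
      exact ((((hI 4 (by norm_num) 0 (by norm_num)).add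
        ((hI 3 (by norm_num) 1 (by norm_num)).const_mul 4)).add
        ((hI 2 (by norm_num) 2 (by norm_num)).const_mul 6)).add
        ((hI 1 (by norm_num) 3 (by norm_num)).const_mul 4)).add
        (hI 0 (by norm_num) 4 (by norm_num))
    have one_f : ∫ x, f x ^ 0 ∂ν = 1 := by simp
    have one_S : ∫ x, S x ^ 0 ∂π = 1 := by simp
    have f1 : ∫ x, f x ^ 1 ∂ν = 0 := by simpa using h0
    have S1 : ∫ x, S x ^ 1 ∂π = 0 := by simpa using i1
    refine ⟨?_, ?_, ?_, ?_⟩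
    · simp only [hsum]
      exact hmp.integrable_comp_of_integrable I4
    · simp only [hsum]
      rw [hint fun z => f z.1 + S z.2, e1,
        integral_add (hI 1 (by norm_num) 0 (by norm_num)) (hI 0 (by norm_num) 1 (by norm_num)),
        hE, hE, f1, S1]
      ring
    · simp only [hsum]
      rw [hint fun z => (f z.1 + S z.2) ^ 2, e2,
        integral_add ((hI 2 (by norm_num) 0 (by norm_num)).fun_add
          ((hI 1 (by norm_num) 1 (by norm_num)).const_mul 2)) (hI 0 (by norm_num) 2 (by norm_num)),
        integral_add (hI 2 (by norm_num) 0 (by norm_num))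
          ((hI 1 (by norm_num) 1 (by norm_num)).const_mul 2), integral_const_mul,
        hE, hE, hE, f1, S1, one_f, one_S, i2]
      push_cast
      ring
    · simp only [hsum]
      have hb := sq_integral_sq_le hf.aestronglyMeasurable h4
      rw [hint fun z => (f z.1 + S z.2) ^ 4, e4,
        integral_add ((((hI 4 (by norm_num) 0 (by norm_num)).fun_add
          ((hI 3 (by norm_num) 1 (by norm_num)).const_mul 4)).fun_add
          ((hI 2 (by norm_num) 2 (by norm_num)).const_mul 6)).fun_add
          ((hI 1 (by norm_num) 3 (by norm_num)).const_mul 4)) (hI 0 (by norm_num) 4 (by norm_num)),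
        integral_add (((hI 4 (by norm_num) 0 (by norm_num)).fun_add
          ((hI 3 (by norm_num) 1 (by norm_num)).const_mul 4)).fun_add
          ((hI 2 (by norm_num) 2 (by norm_num)).const_mul 6))
          ((hI 1 (by norm_num) 3 (by norm_num)).const_mul 4),
        integral_add ((hI 4 (by norm_num) 0 (by norm_num)).fun_add
          ((hI 3 (by norm_num) 1 (by norm_num)).const_mul 4))
          ((hI 2 (by norm_num) 2 (by norm_num)).const_mul 6),
        integral_add (hI 4 (by norm_num) 0 (by norm_num))
          ((hI 3 (by norm_num) 1 (by norm_num)).const_mul 4),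
        integral_const_mul, integral_const_mul, integral_const_mul,
        hE, hE, hE, hE, hE, f1, S1, one_f, one_S, i2]
      have hm : (0 : ℝ) ≤ m := Nat.cast_nonneg m
      have hb0 : 0 ≤ ∫ x, f x ^ 4 ∂ν := integral_nonneg fun x => by positivity
      push_cast
      -- With `E[f²]² ≤ E[f⁴]` the step reads `1 + 6 * m + 3 * m ^ 2 ≤ 3 * (m + 1) ^ 2`.
      nlinarith [mul_le_mul_of_nonneg_left hb hm]

/-- The empirical mean of `m` independent copies of a centred variable exceeds `t` with
probability at most `3 E[f⁴] / (m² t⁴)`. -/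
theorem measure_lt_abs_mean_le {f : Ω → ℝ} (hf : Measurable f)
    (h4 : Integrable (fun x => f x ^ 4) ν) (h0 : ∫ x, f x ∂ν = 0) {m : ℕ} (hm : 0 < m) {t : ℝ}
    (ht : 0 < t) :
    (Measure.pi fun _ : Fin m => ν).real {v | t < |(m : ℝ)⁻¹ * ∑ i, f (v i)|} ≤
      3 * (∫ x, f x ^ 4 ∂ν) / ((m : ℝ) ^ 2 * t ^ 4) := by
  obtain ⟨i4, -, -, i3⟩ := moments_sum_pi hf h4 h0 m
  have hm' : (0 : ℝ) < m := Nat.cast_pos.2 hm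
  have hmk := mul_meas_ge_le_integral_of_nonneg
    (Filter.Eventually.of_forall fun v => by positivity) i4 ((m * t) ^ 4)
  have hsub : (Measure.pi fun _ : Fin m => ν).real {v | t < |(m : ℝ)⁻¹ * ∑ i, f (v i)|} ≤
      (Measure.pi fun _ : Fin m => ν).real {v | (m * t) ^ 4 ≤ (∑ i, f (v i)) ^ 4} := by
    refine measureReal_mono fun v hv => ?_
    simp only [Set.mem_ofPred_eq] at hv ⊢
    rw [abs_mul, abs_of_pos (inv_pos.2 hm'), inv_mul_eq_div, lt_div_iff₀ hm'] at hv
    rw [← Even.pow_abs (by decide) (∑ i, f (v i))]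
    exact pow_le_pow_left₀ (by positivity) (by linarith) 4
  refine hsub.trans ?_
  rw [le_div_iff₀ (by positivity)]
  have h := hmk.trans i3
  have e : ((m : ℝ) * t) ^ 4 = m ^ 2 * (m ^ 2 * t ^ 4) := by ring
  rw [e] at h
  have hm2 : (0 : ℝ) < (m : ℝ) ^ 2 := by positivity
  refine le_of_mul_le_mul_left ?_ hm2
  rw [e]
  linarith

end FourthMoment

/-! ### Moments of a Gaussian vector -/

theorem exp_dotProduct {n : ℕ} (u v : Fin n → ℝ) :
    Real.exp (u ⬝ᵥ v) = ∏ k, Real.exp (u k * v k) := by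
  rw [dotProduct, Real.exp_sum]

theorem integrable_exp_dotProduct {n : ℕ} (u : Fin n → ℝ) :
    Integrable (fun v => Real.exp (u ⬝ᵥ v)) (gaussianVec n) := by
  simp only [exp_dotProduct]
  exact Integrable.fintype_prod (f := fun k x => Real.exp (u k * x))
    fun k => integrable_exp_mul_gaussianReal (u k)

theorem integral_exp_dotProduct {n : ℕ} (u : Fin n → ℝ) :
    ∫ v, Real.exp (u ⬝ᵥ v) ∂(gaussianVec n) = Real.exp ((∑ k, u k ^ 2) / 2) := by
  simp only [exp_dotProduct]
  rw [gaussianVec, integral_fintype_prod_eq_prod (f := fun k x => Real.exp (u k * x)),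
    Finset.sum_div, Real.exp_sum]
  refine Finset.prod_congr rfl fun k _ => ?_
  have h := congrFun (mgf_id_gaussianReal (μ := 0) (v := 1)) (u k)
  simpa [mgf] using h

/-- Bounds eighth moments by the Gaussian moment generating function, which avoids computing them;
`40320 = 8!`. -/
theorem pow_eight_le_exp (x : ℝ) : x ^ 8 ≤ 40320 * (Real.exp x + Real.exp (-x)) := by
  have h := Real.pow_div_factorial_le_exp |x| (abs_nonneg x) 8
  rw [Even.pow_abs (by decide), div_le_iff₀ (by positivity)] at h
  have e : ((Nat.factorial 8 : ℕ) : ℝ) = 40320 := by norm_num [Nat.factorial]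
  rw [e] at h
  have h2 : Real.exp |x| ≤ Real.exp x + Real.exp (-x) := by
    rcases abs_cases x with ⟨hx, -⟩ | ⟨hx, -⟩ <;> rw [hx] <;>
      linarith [Real.exp_pos x, Real.exp_pos (-x)]
  linarith

theorem measurable_dotProduct {n : ℕ} (u : Fin n → ℝ) :
    Measurable fun v : Fin n → ℝ => u ⬝ᵥ v :=
  Finset.measurable_sum _ fun k _ => (measurable_pi_apply k).const_mul _

theorem integrable_dotProduct_pow_eight {n : ℕ} (u : Fin n → ℝ) :
    Integrable (fun v => (u ⬝ᵥ v) ^ 8) (gaussianVec n) := by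
  refine Integrable.mono' (((integrable_exp_dotProduct u).add
    (integrable_exp_dotProduct (-u))).const_mul 40320)
    ((measurable_dotProduct u).pow_const 8).aestronglyMeasurable
    (Filter.Eventually.of_forall fun v => ?_)
  rw [Real.norm_eq_abs, abs_of_nonneg (by positivity)]
  simpa [neg_dotProduct] using pow_eight_le_exp (u ⬝ᵥ v)

theorem integral_dotProduct_pow_eight_le {n : ℕ} {u : Fin n → ℝ} (hu : ∑ k, u k ^ 2 = 1) :
    ∫ v, (u ⬝ᵥ v) ^ 8 ∂(gaussianVec n) ≤ 241920 := by
  have h : ∫ v, (u ⬝ᵥ v) ^ 8 ∂(gaussianVec n) ≤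
      ∫ v, 40320 * (Real.exp (u ⬝ᵥ v) + Real.exp (-u ⬝ᵥ v)) ∂(gaussianVec n) := by
    refine integral_mono (integrable_dotProduct_pow_eight u)
      (((integrable_exp_dotProduct u).add (integrable_exp_dotProduct (-u))).const_mul 40320)
      fun v => ?_
    simpa [neg_dotProduct] using pow_eight_le_exp (u ⬝ᵥ v)
  rw [integral_const_mul, integral_add (integrable_exp_dotProduct u)
    (integrable_exp_dotProduct (-u)), integral_exp_dotProduct, integral_exp_dotProduct] at h
  simp only [Pi.neg_apply, neg_sq, hu] at h
  have h3 : Real.exp (1 / 2) ≤ 3 :=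
    (Real.exp_le_exp.2 (by norm_num)).trans (Real.exp_one_lt_d9.le.trans (by norm_num))
  linarith

theorem single_one_dotProduct {n : ℕ} (k : Fin n) (v : Fin n → ℝ) :
    (Pi.single k 1 : Fin n → ℝ) ⬝ᵥ v = v k := by simp

theorem sum_single_sq {n : ℕ} (k : Fin n) : ∑ l, (Pi.single k 1 : Fin n → ℝ) l ^ 2 = 1 := by
  rw [Finset.sum_eq_single k]
  · simp
  · intro l _ hl; simp [Pi.single_eq_of_ne hl]
  · simp

/-- The centred forward gradient of the linear function with gradient `u`, in coordinate `k`. -/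
def centredForward {n : ℕ} (u : Fin n → ℝ) (k : Fin n) (v : Fin n → ℝ) : ℝ :=
  (u ⬝ᵥ v) * v k - u k

theorem measurable_centredForward {n : ℕ} (u : Fin n → ℝ) (k : Fin n) :
    Measurable (centredForward u k) :=
  ((measurable_dotProduct u).mul (measurable_pi_apply k)).sub_const _

theorem integrable_dotProduct_mul {n : ℕ} (u : Fin n → ℝ) (k : Fin n) :
    Integrable (fun v => (u ⬝ᵥ v) * v k) (gaussianVec n) := by
  have hk := integrable_dotProduct_pow_eight (Pi.single k 1 : Fin n → ℝ)
  simp only [single_one_dotProduct] at hk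
  refine Integrable.mono' (((integrable_const 1).add (integrable_dotProduct_pow_eight u)).add hk)
    ((measurable_dotProduct u).mul (measurable_pi_apply k)).aestronglyMeasurable
    (Filter.Eventually.of_forall fun v => ?_)
  simp only [Pi.add_apply, Real.norm_eq_abs]
  have key : ∀ x : ℝ, x ^ 2 ≤ 1 + x ^ 8 := by
    intro x
    nlinarith [sq_nonneg (x ^ 4 - 1 / 2), sq_nonneg (x ^ 2 - 1 / 2)]
  have h1 := key (u ⬝ᵥ v)
  have h2 := key (v k)
  have h3 : 0 ≤ (u ⬝ᵥ v) ^ 8 := by positivity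
  have h4 : 0 ≤ v k ^ 8 := by positivity
  rw [abs_le]
  constructor <;> nlinarith [sq_nonneg (u ⬝ᵥ v - v k), sq_nonneg (u ⬝ᵥ v + v k)]

theorem integral_sq_gaussianReal : ∫ x, x ^ 2 ∂(gaussianReal 0 1) = 1 := by
  have h := variance_id_gaussianReal (μ := 0) (v := 1)
  rw [variance_of_integral_eq_zero measurable_id.aemeasurable] at h
  · simpa using h
  · simp

theorem integral_apply_mul_apply {n : ℕ} (j k : Fin n) :
    ∫ v, v j * v k ∂(gaussianVec n) = if j = k then 1 else 0 := by
  have e : ∀ v : Fin n → ℝ, v j * v k =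
      ∏ l, ((if l = j then v l else 1) * (if l = k then v l else 1)) := by
    intro v
    rw [Finset.prod_mul_distrib]
    simp
  simp only [e]
  rw [gaussianVec, integral_fintype_prod_eq_prod
    (f := fun l x => (if l = j then x else 1) * (if l = k then x else 1))]
  split_ifs with h
  · subst h
    rw [Finset.prod_eq_one]
    intro l _
    by_cases hl : l = j
    · simpa [hl, ← sq] using integral_sq_gaussianReal
    · simp [hl]
  · refine Finset.prod_eq_zero (Finset.mem_univ j) ?_
    simp [h]

theorem integral_dotProduct_mul {n : ℕ} (u : Fin n → ℝ) (k : Fin n) :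
    ∫ v, (u ⬝ᵥ v) * v k ∂(gaussianVec n) = u k := by
  have e : ∀ v : Fin n → ℝ, (u ⬝ᵥ v) * v k = ∑ j, u j * (v j * v k) := by
    intro v
    rw [dotProduct, Finset.sum_mul]
    exact Finset.sum_congr rfl fun j _ => by ring
  simp only [e]
  rw [integral_finsetSum]
  · simp [integral_const_mul, integral_apply_mul_apply]
  · intro j _
    have := integrable_dotProduct_mul (Pi.single j 1 : Fin n → ℝ) k
    simp only [single_one_dotProduct] at this
    exact this.const_mul _

theorem integral_centredForward {n : ℕ} (u : Fin n → ℝ) (k : Fin n) :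
    ∫ v, centredForward u k v ∂(gaussianVec n) = 0 := by
  simp only [centredForward]
  rw [integral_sub (integrable_dotProduct_mul u k) (integrable_const _), integral_dotProduct_mul]
  simp

theorem centredForward_pow_four_le {n : ℕ} (u : Fin n → ℝ) (k : Fin n) (v : Fin n → ℝ) :
    centredForward u k v ^ 4 ≤ 4 * (u ⬝ᵥ v) ^ 8 + 4 * v k ^ 8 + 8 * u k ^ 4 := by
  rw [centredForward]
  set a := u ⬝ᵥ v
  have h1 : ∀ x y : ℝ, (x - y) ^ 4 ≤ 8 * x ^ 4 + 8 * y ^ 4 := by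
    intro x y
    have h2 : (x - y) ^ 2 ≤ 2 * x ^ 2 + 2 * y ^ 2 := by nlinarith [sq_nonneg (x + y)]
    calc (x - y) ^ 4 = ((x - y) ^ 2) ^ 2 := by ring
      _ ≤ (2 * x ^ 2 + 2 * y ^ 2) ^ 2 := pow_le_pow_left₀ (sq_nonneg _) h2 2
      _ ≤ _ := by nlinarith [sq_nonneg (x ^ 2 - y ^ 2)]
  have h3 := h1 (a * v k) (u k)
  nlinarith [sq_nonneg (a ^ 4 - v k ^ 4)]

theorem integrable_centredForward_pow_four {n : ℕ} (u : Fin n → ℝ) (k : Fin n) :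
    Integrable (fun v => centredForward u k v ^ 4) (gaussianVec n) := by
  have hk := integrable_dotProduct_pow_eight (Pi.single k 1 : Fin n → ℝ)
  simp only [single_one_dotProduct] at hk
  refine Integrable.mono' ((((integrable_dotProduct_pow_eight u).const_mul 4).add
    (hk.const_mul 4)).add (integrable_const (8 * u k ^ 4)))
    ((measurable_centredForward u k).pow_const 4).aestronglyMeasurable
    (Filter.Eventually.of_forall fun v => ?_)
  rw [Real.norm_eq_abs, abs_of_nonneg (by positivity)]
  exact centredForward_pow_four_le u k v

theorem integral_centredForward_pow_four_le_of_sum_sq_eq_one {n : ℕ} {u : Fin n → ℝ}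
    (hu : ∑ k, u k ^ 2 = 1) (k : Fin n) :
    ∫ v, centredForward u k v ^ 4 ∂(gaussianVec n) ≤ 2000000 := by
  have hk := integrable_dotProduct_pow_eight (Pi.single k 1 : Fin n → ℝ)
  have hk' := integral_dotProduct_pow_eight_le (sum_single_sq k)
  simp only [single_one_dotProduct] at hk hk'
  have h8 := integrable_dotProduct_pow_eight u
  have h := integral_mono (integrable_centredForward_pow_four u k)
    (((h8.const_mul 4).add (hk.const_mul 4)).add (integrable_const (8 * u k ^ 4)))
    fun v => centredForward_pow_four_le u k v
  simp only [Pi.add_apply] at h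
  rw [integral_add ((h8.const_mul 4).fun_add (hk.const_mul 4)) (integrable_const _),
    integral_add (h8.const_mul 4) (hk.const_mul 4), integral_const_mul, integral_const_mul] at h
  simp only [integral_const, probReal_univ, smul_eq_mul, one_mul] at h
  have h1 := integral_dotProduct_pow_eight_le hu
  have h2 : u k ^ 2 ≤ 1 :=
    hu ▸ Finset.single_le_sum (f := fun k => u k ^ 2) (fun l _ => sq_nonneg _) (Finset.mem_univ k)
  nlinarith [sq_nonneg (u k)]

/-- By homogeneity in `u` this reduces to unit vectors; `u = 0` is separate because it cannot be
normalised. -/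
theorem integral_centredForward_pow_four_le {n : ℕ} (u : Fin n → ℝ) (k : Fin n) :
    ∫ v, centredForward u k v ^ 4 ∂(gaussianVec n) ≤ 2000000 * (∑ k, u k ^ 2) ^ 2 := by
  set U := ∑ k, u k ^ 2 with hU
  have hU0 : 0 ≤ U := Finset.sum_nonneg fun k _ => sq_nonneg _
  rcases hU0.eq_or_lt with h | h
  · have hz : u = 0 := by
      funext l
      have := (Finset.sum_eq_zero_iff_of_nonneg fun k _ => sq_nonneg (u k)).1
        (hU ▸ h.symm : ∑ k, u k ^ 2 = 0) l (Finset.mem_univ l)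
      simpa using this
    rw [← h]
    simp [hz, centredForward]
  · have hs : 0 < √U := Real.sqrt_pos.2 h
    have hs2 : √U ^ 2 = U := Real.sq_sqrt hU0
    set w : Fin n → ℝ := (√U)⁻¹ • u with hw
    have huw : u = √U • w := by rw [hw, smul_smul, mul_inv_cancel₀ hs.ne', one_smul]
    have hw1 : ∑ k, w k ^ 2 = 1 := by
      simp only [hw, Pi.smul_apply, smul_eq_mul, mul_pow, ← Finset.mul_sum, ← hU, inv_pow, hs2]
      exact inv_mul_cancel₀ h.ne'
    have hc : ∀ v, centredForward u k v ^ 4 = U ^ 2 * centredForward w k v ^ 4 := by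
      intro v
      have : centredForward u k v = √U * centredForward w k v := by
        conv_lhs => rw [huw]
        simp only [centredForward, smul_dotProduct, Pi.smul_apply, smul_eq_mul]
        ring
      have hs4 : √U ^ 4 = U ^ 2 := by rw [← hs2, ← pow_mul, hs2]
      rw [this, mul_pow, hs4]
    simp only [hc]
    rw [integral_const_mul, mul_comm]
    exact mul_le_mul_of_nonneg_right
      (integral_centredForward_pow_four_le_of_sum_sq_eq_one hw1 k) (sq_nonneg _)

/-- With high probability, the empirical mean of `m` forward gradients of a linear function is
close to its gradient, in every coordinate. -/
theorem measure_forward_deviation_le {n m : ℕ} (hm : 0 < m) (u : Fin n → ℝ) {t : ℝ}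
    (ht : 0 < t) (k : Fin n) :
    (Measure.pi fun _ : Fin m => gaussianVec n).real
        {v | t < |(m : ℝ)⁻¹ * ∑ i, centredForward u k (v i)|} ≤
      6000000 * (∑ k, u k ^ 2) ^ 2 / ((m : ℝ) ^ 2 * t ^ 4) := by
  refine (measure_lt_abs_mean_le (measurable_centredForward u k)
    (integrable_centredForward_pow_four u k) (integral_centredForward u k) hm ht).trans ?_
  have h := integral_centredForward_pow_four_le u k
  exact div_le_div_of_nonneg_right (by linarith) (by positivity)

end ForwardGradient

namespace ForwardGradient

/-! ### The gradient of the mean loss -/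

namespace Problem

variable {d n c₁ c₂ : ℕ} (P : Problem d n c₁ c₂)

/-- The mean of the gradient over the input. -/
def meanGrad : Fin n → ℝ := fun k => ∑ x, P.p x * P.grad x k

theorem norm_sq_loader_zero (x : XReg d c₁ c₂) : ‖P.loader.1 x XReg.zero‖ ^ 2 = P.p x := by
  rw [P.loader_zero, Complex.norm_real, Real.norm_eq_abs, sq_abs, Real.sq_sqrt (P.p_nonneg x)]

theorem loader_zero_ne_zero_iff (x : XReg d c₁ c₂) :
    P.loader.1 x XReg.zero ≠ 0 ↔ 0 < P.p x := by
  rw [← P.norm_sq_loader_zero, sq_pos_iff, norm_ne_zero_iff]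

theorem meanDirDeriv_eq (v : Fin n → ℝ) : P.meanDirDeriv v = P.meanGrad ⬝ᵥ v := by
  simp only [meanDirDeriv, dirDeriv, dotProduct, meanGrad, Finset.sum_mul, Finset.mul_sum]
  rw [Finset.sum_comm]
  exact Finset.sum_congr rfl fun k _ => Finset.sum_congr rfl fun x _ => by ring

theorem meanForwardGrad_eq : P.meanForwardGrad = P.meanGrad := by
  funext k
  have e : ∀ v, ∑ x, P.p x * (P.dirDeriv v x * v k) = (P.meanGrad ⬝ᵥ v) * v k := by
    intro v
    rw [← P.meanDirDeriv_eq, meanDirDeriv, Finset.sum_mul]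
    exact Finset.sum_congr rfl fun x _ => by ring
  simp only [meanForwardGrad, e, integral_dotProduct_mul]

theorem gradMeanLoss_eq : P.gradMeanLoss = P.meanGrad := by
  have hterm : ∀ x, HasFDerivAt (fun θ => P.p x * P.f x.point θ)
      (P.p x • fderiv ℝ (P.f x.point) P.θ) P.θ := by
    intro x
    -- Outside the support differentiability is not assumed, but there the summand is identically
    -- zero.
    rcases (P.p_nonneg x).eq_or_lt with h | h
    · simpa [← h] using hasFDerivAt_const (0 : ℝ) P.θ
    · exact (P.differentiableAt x h).hasFDerivAt.const_mul (P.p x)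
  have hsum : HasFDerivAt (fun θ => ∑ x, P.p x * P.f x.point θ)
      (∑ x, P.p x • fderiv ℝ (P.f x.point) P.θ) P.θ :=
    HasFDerivAt.fun_sum fun x _ => hterm x
  funext k
  have h : gradient (fun θ => ∑ x, P.p x * P.f x.point θ) P.θ =
      ∑ x, P.p x • gradient (P.f x.point) P.θ := by
    simp [gradient, hsum.fderiv, map_sum]
  simp [gradMeanLoss, h, meanGrad, grad]

variable {P} {g : ℝ}

theorem abs_grad_le (hg : P.gMax ≤ g) {x : XReg d c₁ c₂} (hx : 0 < P.p x) (k : Fin n) :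
    |P.grad x k| ≤ √g := by
  have h1 : ‖P.grad x‖ ^ 2 ≤ P.gMax :=
    le_ciSup (f := fun x : {x : XReg d c₁ c₂ // 0 < P.p x} => ‖P.grad x‖ ^ 2)
      (Set.finite_range _).bddAbove ⟨x, hx⟩
  exact (norm_le_pi_norm (P.grad x) k).trans (Real.le_sqrt_of_sq_le (h1.trans hg))

theorem abs_meanGrad_le (hg : P.gMax ≤ g) (k : Fin n) : |P.meanGrad k| ≤ √g := by
  refine (Finset.abs_sum_le_sum_abs _ _).trans ?_
  rw [← one_mul (√g), ← P.p_sum, Finset.sum_mul]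
  refine Finset.sum_le_sum fun x _ => ?_
  rw [abs_mul, abs_of_nonneg (P.p_nonneg x)]
  rcases (P.p_nonneg x).eq_or_lt with h | h
  · simp [← h]
  · exact mul_le_mul_of_nonneg_left (abs_grad_le hg h k) h.le

theorem abs_dirDeriv_le_sum (hg : P.gMax ≤ g) {x : XReg d c₁ c₂} (hx : 0 < P.p x)
    (v : Fin n → ℝ) : |P.dirDeriv v x| ≤ √g * ∑ k, |v k| := by
  rw [dirDeriv, dotProduct, Finset.mul_sum]
  refine (Finset.abs_sum_le_sum_abs _ _).trans (Finset.sum_le_sum fun k _ => ?_)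
  rw [abs_mul]
  exact mul_le_mul_of_nonneg_right (abs_grad_le hg hx k) (abs_nonneg _)

theorem abs_dirDeriv_le (hg0 : 0 ≤ g) (hg : P.gMax ≤ g) {x : XReg d c₁ c₂} (hx : 0 < P.p x)
    (v : Fin n → ℝ) : |P.dirDeriv v x| ≤ √(g * n) * norm2 v := by
  refine (abs_dirDeriv_le_sum hg hx v).trans ?_
  rw [Real.sqrt_mul hg0, mul_assoc]
  refine mul_le_mul_of_nonneg_left ?_ (Real.sqrt_nonneg g)
  rw [norm2, ← Real.sqrt_mul (Nat.cast_nonneg n)]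
  refine Real.le_sqrt_of_sq_le ?_
  simpa using sq_sum_le_card_mul_sum_sq (s := Finset.univ) (f := fun k => |v k|)

theorem abs_mean_le {y : XReg d c₁ c₂ → ℝ} {b : ℝ} (h : ∀ x, 0 < P.p x → |y x| ≤ b) :
    |∑ x, P.p x * y x| ≤ b := by
  refine (Finset.abs_sum_le_sum_abs _ _).trans ?_
  rw [← one_mul b, ← P.p_sum, Finset.sum_mul]
  refine Finset.sum_le_sum fun x _ => ?_
  rw [abs_mul, abs_of_nonneg (P.p_nonneg x)]
  rcases (P.p_nonneg x).eq_or_lt with h0 | h0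
  · simp [← h0]
  · exact mul_le_mul_of_nonneg_left (h x h0) h0.le

end Problem

/-! ### The inner loop -/

/-- Trisection from the interval `[-1, 1]`, after scaling by `B = 2 * b`, where `b` bounds the
directional derivatives; the factor `2` leaves room for rounding. The error `ε / 4` consists of `ε /
8` from the last interval and `ε / 8` from rounding. -/
theorem exists_estimator (d n : ℕ) {c₁ c₂ : ℕ} {g ε δ : ℝ} (hg : 0 ≤ g) (hε : 0 < ε) (hδ : 0 < δ)
    (hc₂ : ((2 : ℝ) ^ c₂)⁻¹ ≤ ε / 8) (v : Fin n → ℝ) :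
    ∃ A : QAlgorithm d c₁ c₂,
      (A.queries : ℝ) ≤ (16 * ⌈1000 * Real.log δ⁻¹⌉₊ + 48000) * (24 * (√(g * n) * norm2 v / ε)) ∧
      ∀ P : Problem d n c₁ c₂, P.gMax ≤ g →
        (∀ x, 0 < P.p x → |P.dirDeriv v x| ≤ FixedPt.range c₁ c₂) →
        ENNReal.ofReal (1 - δ) ≤
          (A.law (P.oracle v)).toMeasure {w | |w - P.meanDirDeriv v| ≤ ε / 4} := by
  set b := √(g * n) * norm2 v with hb
  have hb0 : 0 ≤ b := mul_nonneg (Real.sqrt_nonneg _) (Real.sqrt_nonneg _)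
  set N₀ := ⌈1000 * Real.log δ⁻¹⌉₊ with hN₀
  have hmeas : ∀ z η : ℝ, MeasurableSet {w : ℝ | |w - z| ≤ η} := fun z η =>
    measurableSet_le (by fun_prop) measurable_const
  -- For small `b` the query bound may be below one, so the algorithm must output `0` without
  -- querying.
  rcases le_or_gt b (ε / 4) with hsmall | hbig
  · refine ⟨.ret 0, by simp only [QAlgorithm.queries, Nat.cast_zero]; positivity,
      fun P hP _ => ?_⟩
    refine QAlgorithm.le_toMeasure_law _ (hmeas _ _) _ ?_
    rw [QAlgorithm.prob, Set.indicator_of_notMem]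
    · exact hδ.le
    · rw [Set.notMem_compl_iff, Set.mem_ofPred_eq, zero_sub, abs_neg]
      exact P.abs_mean_le fun x hx => (P.abs_dirDeriv_le hg hP hx v).trans hsmall
  · have hb1 : 0 < b := by linarith
    -- After `J + 1` stages the scaled half-width `(2 / 3) ^ (J + 1) * (2 * b)` is below `ε / 8`,
    -- and by minimality it is not much smaller, which bounds the cost.
    obtain ⟨J, hJ1, hJ2⟩ := exists_nat_pow_near (x := 16 * b / ε) (y := (3 / 2 : ℝ))
      (by rw [one_le_div hε]; linarith) (by norm_num)
    refine ⟨.refine (2 * b) N₀ (J + 1) 1 0, ?_, fun P hP hrange => ?_⟩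
    · refine (QAlgorithm.queries_refine_le (2 * b) N₀ (J + 1) one_pos le_rfl 0).trans ?_
      rw [div_one]
      have h1 : (3 / 2 : ℝ) ^ (J + 1) ≤ 24 * (b / ε) := by
        rw [pow_succ]
        have : 16 * b / ε = 16 * (b / ε) := mul_div_assoc _ _ _
        linarith
      have h2 : (0 : ℝ) ≤ 16 * N₀ + 48000 := by positivity
      have h3 : (0 : ℝ) ≤ 16000 * ((J + 1 : ℕ) : ℝ) := by positivity
      have := mul_le_mul_of_nonneg_left h1 h2
      linarith
    · set O := P.oracle v with hO
      have hval : ∀ x, 0 < P.p x → |(O.h x).value - P.dirDeriv v x| ≤ ε / 8 := fun x hx =>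
        (FixedPt.abs_value_encode_sub_le (hrange x hx)).trans hc₂
      have hwt : ∀ x, ‖O.loader.1 x XReg.zero‖ ^ 2 = P.p x := P.norm_sq_loader_zero
      have hbnd : ∀ x, 0 < P.p x → |(O.h x).value / (2 * b)| ≤ 1 := by
        intro x hx
        rw [abs_div, abs_of_pos (by linarith : 0 < 2 * b), div_le_one (by linarith)]
        have h1 := P.abs_dirDeriv_le hg hP hx v
        have h2 := abs_sub_abs_le_abs_sub (O.h x).value (P.dirDeriv v x)
        have h3 := hval x hx
        rw [← hb] at h1
        linarith
      have hη : (2 / 3 : ℝ) ^ (J + 1) * 1 * (2 * b) ≤ ε / 8 := by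
        have h1 : (2 / 3 : ℝ) ^ (J + 1) = ((3 / 2) ^ (J + 1))⁻¹ := by rw [← inv_pow]; norm_num
        rw [mul_one, h1, inv_mul_le_iff₀ (by positivity)]
        rw [div_lt_iff₀ hε] at hJ2
        linarith
      have hmean : |∑ x, P.p x * ((O.h x).value / (2 * b))| ≤ 1 := P.abs_mean_le hbnd
      have hN : Real.exp (-(N₀ / 1000)) ≤ δ := by
        rw [← Real.exp_log hδ]
        refine Real.exp_le_exp.2 ?_
        have := Nat.le_ceil (1000 * Real.log δ⁻¹)
        rw [← hN₀, Real.log_inv] at this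
        linarith
      have hp := QAlgorithm.prob_refine_le O (B := 2 * b) (η := ε / 8) (by linarith) hN
        (by simp only [hwt]; exact P.p_sum)
        (fun x hx => hbnd x ((P.loader_zero_ne_zero_iff x).1 hx)) rfl (J + 1)
        (r := 1) (c := 0) one_pos (by norm_num) (by norm_num)
        (by simp only [hwt, sub_zero]; exact hmean) hη
      have hmul : (∑ x, P.p x * ((O.h x).value / (2 * b))) * (2 * b) =
          ∑ x, P.p x * (O.h x).value := by
        rw [Finset.sum_mul]
        exact Finset.sum_congr rfl fun x _ => by field_simp
      simp only [hwt, hmul] at hp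
      have hp' := hp.trans (mul_le_of_le_one_right hδ.le
        (sub_le_self 1 (by positivity : (0 : ℝ) ≤ (1 / 2) ^ (J + 1))))
      refine (QAlgorithm.le_toMeasure_law O (hmeas _ _) _ hp').trans (measure_mono fun w hw => ?_)
      rw [Set.mem_ofPred_eq] at hw ⊢
      have hround : |∑ x, P.p x * (O.h x).value - P.meanDirDeriv v| ≤ ε / 8 := by
        rw [Problem.meanDirDeriv, ← Finset.sum_sub_distrib]
        simp only [← mul_sub]
        exact P.abs_mean_le hval
      calc |w - P.meanDirDeriv v| ≤ |w - ∑ x, P.p x * (O.h x).value| +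
            |∑ x, P.p x * (O.h x).value - P.meanDirDeriv v| := abs_sub_le _ _ _
        _ ≤ ε / 4 := by linarith

/-! ### The outer loop -/

/-- The event that the empirical means of `(e k · v) v k` and `(u · v) v k` are close to their
expectations, for all coordinates `k`. -/
def goodDirections {n : ℕ} (m : ℕ) (u : Fin n → ℝ) (t : ℝ) : Set (Fin m → Fin n → ℝ) :=
  {v | ∀ k, |(m : ℝ)⁻¹ * ∑ i, centredForward (Pi.single k 1) k (v i)| ≤ 1 ∧
    |(m : ℝ)⁻¹ * ∑ i, centredForward u k (v i)| ≤ t}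

theorem measurable_mean_centredForward {n : ℕ} (m : ℕ) (u : Fin n → ℝ) (k : Fin n) :
    Measurable fun v : Fin m → Fin n → ℝ => |(m : ℝ)⁻¹ * ∑ i, centredForward u k (v i)| :=
  ((Finset.measurable_sum _ fun i _ =>
    (measurable_centredForward u k).comp (measurable_pi_apply i)).const_mul _).abs

theorem measurableSet_goodDirections {n : ℕ} (m : ℕ) (u : Fin n → ℝ) (t : ℝ) :
    MeasurableSet (goodDirections m u t) := by
  have h : goodDirections m u t = ⋂ k,
      {v | |(m : ℝ)⁻¹ * ∑ i, centredForward (Pi.single k 1) k (v i)| ≤ 1} ∩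
        {v | |(m : ℝ)⁻¹ * ∑ i, centredForward u k (v i)| ≤ t} := by
    ext v; simp [goodDirections]
  rw [h]
  exact MeasurableSet.iInter fun k =>
    (measurableSet_le (measurable_mean_centredForward m _ k) measurable_const).inter
      (measurableSet_le (measurable_mean_centredForward m u k) measurable_const)

theorem measure_compl_goodDirections_le {n m : ℕ} (hm : 0 < m) (u : Fin n → ℝ) {t : ℝ}
    (ht : 0 < t) :
    (Measure.pi fun _ : Fin m => gaussianVec n).real (goodDirections m u t)ᶜ ≤
      n * (6000000 / (m : ℝ) ^ 2 + 6000000 * (∑ k, u k ^ 2) ^ 2 / ((m : ℝ) ^ 2 * t ^ 4)) := by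
  set π := Measure.pi fun _ : Fin m => gaussianVec n
  have hsub : (goodDirections m u t)ᶜ ⊆ ⋃ k,
      ({v | 1 < |(m : ℝ)⁻¹ * ∑ i, centredForward (Pi.single k 1) k (v i)|} ∪
        {v | t < |(m : ℝ)⁻¹ * ∑ i, centredForward u k (v i)|}) := by
    intro v hv
    simp only [goodDirections, Set.mem_compl_iff, Set.mem_ofPred_eq, not_forall, not_and_or,
      not_le] at hv
    simpa using hv
  refine (measureReal_mono hsub).trans ((measureReal_iUnion_fintype_le _).trans ?_)
  have hk : ∀ k, π.real ({v | 1 < |(m : ℝ)⁻¹ * ∑ i, centredForward (Pi.single k 1) k (v i)|} ∪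
        {v | t < |(m : ℝ)⁻¹ * ∑ i, centredForward u k (v i)|}) ≤
      6000000 / (m : ℝ) ^ 2 + 6000000 * (∑ k, u k ^ 2) ^ 2 / ((m : ℝ) ^ 2 * t ^ 4) := by
    intro k
    refine (measureReal_union_le _ _).trans (add_le_add ?_
      (measure_forward_deviation_le hm u ht k))
    simpa only [sum_single_sq, one_pow, mul_one] using
      measure_forward_deviation_le hm (Pi.single k 1) one_pos k
  refine (Finset.sum_le_sum fun k _ => hk k).trans (le_of_eq ?_)
  rw [Finset.sum_const, Finset.card_univ, Fintype.card_fin, nsmul_eq_mul]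

section GoodDirections

variable {n m : ℕ} {u : Fin n → ℝ} {t : ℝ} {v : Fin m → Fin n → ℝ}

/-- For the basis vector at `k`, the centred forward gradient in coordinate `k` is `v k ^ 2 - 1`. -/
theorem sum_sq_le_of_mem_goodDirections (hm : 0 < m) (hv : v ∈ goodDirections m u t)
    (k : Fin n) : ∑ i, v i k ^ 2 ≤ 2 * m := by
  have hm' : (0 : ℝ) < m := Nat.cast_pos.2 hm
  have h := (abs_le.1 (hv k).1).2
  simp only [centredForward, single_one_dotProduct, Pi.single_eq_same, Finset.sum_sub_distrib,
    Finset.sum_const, Finset.card_univ, Fintype.card_fin, nsmul_eq_mul, mul_one] at h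
  rw [inv_mul_le_iff₀ hm'] at h
  simp only [sq]
  linarith

theorem abs_apply_le_of_mem_goodDirections (hm : 0 < m) (hv : v ∈ goodDirections m u t)
    (i : Fin m) (k : Fin n) : |v i k| ≤ √(2 * m) := by
  refine Real.le_sqrt_of_sq_le ?_
  rw [sq_abs]
  exact (Finset.single_le_sum (f := fun i => v i k ^ 2) (fun _ _ => sq_nonneg _)
    (Finset.mem_univ i)).trans (sum_sq_le_of_mem_goodDirections hm hv k)

/-- Sum `2 * √n * ‖v i‖ ≤ n + ‖v i‖ ^ 2` over `i`; the squares add up to at most `2 * m * n`. -/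
theorem sum_norm2_le_of_mem_goodDirections (hm : 0 < m) (hv : v ∈ goodDirections m u t) :
    ∑ i, norm2 (v i) ≤ 3 / 2 * m * √n := by
  rcases Nat.eq_zero_or_pos n with hn | hn
  · subst hn
    simp [norm2]
  have hn' : (0 : ℝ) < √n := Real.sqrt_pos.2 (Nat.cast_pos.2 hn)
  have hnn : √n * √n = n := Real.mul_self_sqrt (Nat.cast_nonneg n)
  have h1 : ∀ i, 2 * √n * norm2 (v i) ≤ n + ∑ k, v i k ^ 2 := by
    intro i
    have h : norm2 (v i) ^ 2 = ∑ k, v i k ^ 2 :=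
      Real.sq_sqrt (Finset.sum_nonneg fun k _ => sq_nonneg _)
    nlinarith [sq_nonneg (√n - norm2 (v i))]
  have h2 : ∑ i, ∑ k, v i k ^ 2 ≤ n * (2 * m) := by
    rw [Finset.sum_comm]
    refine (Finset.sum_le_sum fun k _ => sum_sq_le_of_mem_goodDirections hm hv k).trans
      (le_of_eq ?_)
    simp
  have h3 := Finset.sum_le_sum fun i (_ : i ∈ Finset.univ) => h1 i
  rw [← Finset.mul_sum, Finset.sum_add_distrib] at h3
  simp only [Finset.sum_const, Finset.card_univ, Fintype.card_fin, nsmul_eq_mul] at h3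
  have h4 : 2 * √n * ∑ i, norm2 (v i) ≤ 2 * √n * (3 / 2 * m * √n) := by
    have : 2 * √n * (3 / 2 * m * √n) = 3 * m * n := by linear_combination 3 * (m : ℝ) * hnn
    rw [this]
    linarith
  exact le_of_mul_le_mul_left h4 (by positivity)

/-- The deviation is a sampling error of at most `ε / 2` plus the inner errors weighted by `v i k`.
As `|v i k| ≤ (1 + v i k ^ 2) / 2` averages to at most `3 / 2`, the latter contribute at most `3 * ε
/ 8`. -/
theorem norm_empiricalMean_sub_le (hm : 0 < m) {ε : ℝ} (hε : 0 < ε)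
    (hv : v ∈ goodDirections m u (ε / 2)) {w : Fin m → ℝ}
    (hw : ∀ i, |w i - u ⬝ᵥ v i| ≤ ε / 4) : ‖empiricalMean v w - u‖ ≤ ε := by
  have hm' : (0 : ℝ) < m := Nat.cast_pos.2 hm
  rw [pi_norm_le_iff_of_nonneg hε.le]
  intro k
  have hsplit : (empiricalMean v w - u) k = (m : ℝ)⁻¹ * ∑ i, centredForward u k (v i) +
      (m : ℝ)⁻¹ * ∑ i, (w i - u ⬝ᵥ v i) * v i k := by
    rw [← mul_add, ← Finset.sum_add_distrib]
    have : ∀ i, centredForward u k (v i) + (w i - u ⬝ᵥ v i) * v i k = w i * v i k - u k := by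
      intro i; rw [centredForward]; ring
    simp only [this, Finset.sum_sub_distrib, Finset.sum_const, Finset.card_univ,
      Fintype.card_fin, nsmul_eq_mul, empiricalMean, Pi.sub_apply, Pi.smul_apply, smul_eq_mul,
      Finset.sum_apply]
    field_simp
  have h2 : |(m : ℝ)⁻¹ * ∑ i, (w i - u ⬝ᵥ v i) * v i k| ≤ ε / 2 := by
    rw [abs_mul, abs_of_pos (inv_pos.2 hm'), inv_mul_le_iff₀ hm']
    have h3 : ∀ i, |(w i - u ⬝ᵥ v i) * v i k| ≤ ε / 4 * ((1 + v i k ^ 2) / 2) := by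
      intro i
      rw [abs_mul]
      refine mul_le_mul (hw i) ?_ (abs_nonneg _) (by linarith)
      nlinarith [sq_nonneg (|v i k| - 1), sq_abs (v i k)]
    refine (Finset.abs_sum_le_sum_abs _ _).trans
      ((Finset.sum_le_sum fun i _ => h3 i).trans ?_)
    rw [← Finset.mul_sum, ← Finset.sum_div, Finset.sum_add_distrib]
    have h4 := sum_sq_le_of_mem_goodDirections hm hv k
    simp only [Finset.sum_const, Finset.card_univ, Fintype.card_fin, nsmul_eq_mul, mul_one]
    nlinarith
  rw [hsplit, Real.norm_eq_abs]
  refine (abs_add_le _ _).trans ?_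
  linarith [(hv k).2]

end GoodDirections

/-- If for all good directions the runs of the inner algorithm succeed with probability at least
`1 - δ` each, and success implies the event `E`, then the nested procedure satisfies `E` with high
probability. -/
theorem le_nestedProb {d n c₁ c₂ m : ℕ} (P : Problem d n c₁ c₂)
    (A : (Fin n → ℝ) → QAlgorithm d c₁ c₂) (E : (Fin m → Fin n → ℝ) → (Fin m → ℝ) → Prop)
    {G : Set (Fin m → Fin n → ℝ)} (hG : MeasurableSet G)
    {S : (Fin m → Fin n → ℝ) → Fin m → Set ℝ} {δ γ : ℝ} (hδ1 : δ ≤ 1) (hmδ : m * δ ≤ 1)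
    (hGm : (Measure.pi fun _ : Fin m => gaussianVec n).real Gᶜ ≤ γ)
    (hS : ∀ v ∈ G, ∀ i,
      ENNReal.ofReal (1 - δ) ≤ ((A (v i)).law (P.oracle (v i))).toMeasure (S v i))
    (hE : ∀ v ∈ G, ∀ w : Fin m → ℝ, (∀ i, w i ∈ S v i) → E v w) :
    ENNReal.ofReal ((1 - m * δ) * (1 - γ)) ≤ nestedProb P m A E := by
  set π := Measure.pi fun _ : Fin m => gaussianVec n
  have hin : ∀ v ∈ G, ENNReal.ofReal (1 - m * δ) ≤
      (Measure.pi fun i => ((A (v i)).law (P.oracle (v i))).toMeasure) {w | E v w} := by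
    intro v hv
    calc ENNReal.ofReal (1 - m * δ) ≤ ENNReal.ofReal ((1 - δ) ^ m) := by
          refine ENNReal.ofReal_le_ofReal ?_
          have := one_add_mul_le_pow (a := -δ) (by linarith) m
          rw [← sub_eq_add_neg] at this
          linarith
      _ = ∏ _i : Fin m, ENNReal.ofReal (1 - δ) := by
          rw [Finset.prod_const, Finset.card_univ, Fintype.card_fin,
            ENNReal.ofReal_pow (by linarith)]
      _ ≤ ∏ i, ((A (v i)).law (P.oracle (v i))).toMeasure (S v i) :=
          Finset.prod_le_prod' fun i _ => hS v hv i
      _ = (Measure.pi fun i => ((A (v i)).law (P.oracle (v i))).toMeasure)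
            (Set.univ.pi (S v)) := (Measure.pi_pi _ _).symm
      -- Only monotonicity is used, so the event `E` need not be measurable.
      _ ≤ _ := measure_mono fun w hw => hE v hv w fun i => hw i (Set.mem_univ i)
  have hπG : ENNReal.ofReal (1 - γ) ≤ π G := by
    have h := probReal_compl_eq_one_sub (μ := π) hG
    rw [← ofReal_measureReal]
    exact ENNReal.ofReal_le_ofReal (by linarith)
  calc ENNReal.ofReal ((1 - m * δ) * (1 - γ))
      = ENNReal.ofReal (1 - m * δ) * ENNReal.ofReal (1 - γ) := ENNReal.ofReal_mul (by linarith)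
    _ ≤ ENNReal.ofReal (1 - m * δ) * π G := by gcongr
    _ = ∫⁻ v, G.indicator (fun _ => ENNReal.ofReal (1 - m * δ)) v ∂π := by
        rw [lintegral_indicator_const hG]
    _ ≤ nestedProb P m A E := by
        refine lintegral_mono fun v => ?_
        by_cases hv : v ∈ G
        · rw [Set.indicator_of_mem hv]
          exact hin v hv
        · rw [Set.indicator_of_notMem hv]
          exact zero_le

end ForwardGradient

/-! ### Choice of the parameters and resulting costs -/

namespace ForwardGradient

/-- The number of outer samples. -/
def outerSamples (n : ℕ) (g ε : ℝ) : ℕ :=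
  if 0 < n ∧ ε ^ 2 < g then ⌈200000 * (n * √n * g / ε ^ 2)⌉₊ else 0

theorem one_le_log_three_add {T : ℝ} (hT : 0 ≤ T) : 1 ≤ Real.log (3 + T) := by
  rw [Real.le_log_iff_exp_le (by linarith)]
  linarith [Real.exp_one_lt_d9]

theorem one_le_sqrt_natCast {n : ℕ} (hn : 0 < n) : 1 ≤ √(n : ℝ) :=
  Real.one_le_sqrt.2 (Nat.one_le_cast.2 hn)

theorem outerSamples_add_one_le {n : ℕ} {g ε : ℝ} (hg : 0 ≤ g) (hε : 0 < ε) :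
    ((outerSamples n g ε : ℕ) : ℝ) + 1 ≤ 200000 * (3 + n * √g / ε) ^ 2 := by
  have hT : 0 ≤ n * √g / ε := by positivity
  rw [outerSamples]
  split_ifs with h
  · have hq : 0 ≤ 200000 * (n * √n * g / ε ^ 2) := by positivity
    have h1 := (Nat.ceil_lt_add_one hq).le
    have h2 : n * √n * g / ε ^ 2 ≤ (n * √g / ε) ^ 2 := by
      rw [div_pow, mul_pow, Real.sq_sqrt hg, sq (n : ℝ)]
      gcongr
      have h3 := one_le_sqrt_natCast h.1
      have h4 : √(n : ℝ) * √n = n := Real.mul_self_sqrt (Nat.cast_nonneg n)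
      nlinarith
    nlinarith
  · push_cast
    nlinarith

/-- The number of outer samples is polynomial in `n * √g / ε`, so a union bound over them costs only
one logarithm. The constant `20` satisfies `1000 * 200000 ≤ exp 20`. -/
theorem repetitions_le {n : ℕ} {g ε : ℝ} (hg : 0 ≤ g) (hε : 0 < ε) :
    (⌈1000 * Real.log ((1 / (1000 * ((outerSamples n g ε : ℕ) + 1)) : ℝ)⁻¹)⌉₊ : ℝ) ≤
      22001 * Real.log (3 + n * √g / ε) := by
  set T := n * √g / ε with hTdef
  have hT : 0 ≤ T := by positivity
  have hL := one_le_log_three_add hT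
  set m : ℕ := outerSamples n g ε with hm
  have hm1 : ((m : ℕ) : ℝ) + 1 ≤ 200000 * (3 + T) ^ 2 := outerSamples_add_one_le hg hε
  have hm0 : (0 : ℝ) ≤ m := Nat.cast_nonneg m
  rw [one_div, inv_inv]
  have hlog0 : 0 ≤ 1000 * Real.log (1000 * (m + 1)) :=
    mul_nonneg (by norm_num) (Real.log_nonneg (by linarith))
  have hlog : Real.log (1000 * (m + 1)) ≤ 20 + 2 * Real.log (3 + T) := by
    have h1 : (200000000 : ℝ) ≤ Real.exp 20 := by
      have h2 : Real.exp 20 = Real.exp 1 ^ 20 := by rw [← Real.exp_nat_mul]; norm_num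
      rw [h2]
      refine le_trans ?_ (pow_le_pow_left₀ (by norm_num) Real.exp_one_gt_d9.le 20)
      norm_num
    have h3 : Real.exp (20 + 2 * Real.log (3 + T)) = Real.exp 20 * (3 + T) ^ 2 := by
      rw [Real.exp_add, two_mul, Real.exp_add, Real.exp_log (by linarith)]; ring
    rw [Real.log_le_iff_le_exp (by linarith), h3]
    nlinarith [sq_nonneg (3 + T)]
  have := (Nat.ceil_lt_add_one hlog0).le
  linarith

theorem sum_meanGrad_sq_le {d n c₁ c₂ : ℕ} {P : Problem d n c₁ c₂} {g : ℝ} (hg0 : 0 ≤ g)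
    (hg : P.gMax ≤ g) : ∑ k, P.meanGrad k ^ 2 ≤ n * g := by
  have h : ∀ k, P.meanGrad k ^ 2 ≤ g := fun k => by
    rw [← Real.sq_sqrt hg0]
    exact sq_le_sq' (abs_le.1 (P.abs_meanGrad_le hg k)).1 (abs_le.1 (P.abs_meanGrad_le hg k)).2
  refine (Finset.sum_le_sum fun k _ => h k).trans (le_of_eq ?_)
  simp

/-- Here `m ^ 2 ≥ 4 * 10 ^ 10 * n ^ 3 * g ^ 2 / ε ^ 4`: one factor `n` pays for the union bound and
`(n * g) ^ 2` for the fourth moment. The basis-vector event needs only `m ^ 2` of order `n`, which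
follows from `ε ^ 2 < g`. -/
theorem measure_compl_goodDirections_outerSamples_le {n : ℕ} {g ε : ℝ} (hε : 0 < ε)
    (h : 0 < n ∧ ε ^ 2 < g) {u : Fin n → ℝ} (hu : ∑ k, u k ^ 2 ≤ n * g) :
    (Measure.pi fun _ : Fin (outerSamples n g ε) => gaussianVec n).real
      (goodDirections (outerSamples n g ε) u (ε / 2))ᶜ ≤ 0.005 := by
  have hn : (0 : ℝ) < n := Nat.cast_pos.2 h.1
  have hn1 : (1 : ℝ) ≤ n := Nat.one_le_cast.2 h.1
  have hε2 : 0 < ε ^ 2 := by positivity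
  have hg : 0 < g := hε2.trans h.2
  have hU0 : 0 ≤ ∑ k, u k ^ 2 := Finset.sum_nonneg fun k _ => sq_nonneg _
  have hm : 200000 * (n * √n * g / ε ^ 2) ≤ (outerSamples n g ε : ℝ) := by
    rw [outerSamples, if_pos h]; exact Nat.le_ceil _
  have hs := one_le_sqrt_natCast h.1
  have hq : 0 < n * √n * g / ε ^ 2 := by positivity
  set m := outerSamples n g ε
  have hm0 : (0 : ℝ) < m := by linarith
  refine (measure_compl_goodDirections_le (Nat.cast_pos.1 hm0) u (by linarith)).trans ?_
  have hm2 : 40000000000 * ((n : ℝ) ^ 3 * g ^ 2 / ε ^ 4) ≤ (m : ℝ) ^ 2 := by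
    have h1 := pow_le_pow_left₀ (by positivity) hm 2
    refine le_trans (le_of_eq ?_) h1
    have h2 : √(n : ℝ) ^ 2 = n := Real.sq_sqrt hn.le
    rw [mul_pow, div_pow, mul_pow, mul_pow, h2]
    ring
  have hge : ε ^ 4 ≤ g ^ 2 := by nlinarith
  have hpos : 0 < 40000000000 * ((n : ℝ) ^ 3 * g ^ 2 / ε ^ 4) := by positivity
  have hA : 6000000 / (m : ℝ) ^ 2 ≤ 3 / 20000 / n := by
    rw [div_le_div_iff₀ (by positivity) hn]
    have h1 : (n : ℝ) ^ 3 ≤ n ^ 3 * g ^ 2 / ε ^ 4 := by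
      rw [le_div_iff₀ (by positivity)]
      gcongr
    have h2 : (n : ℝ) ≤ n ^ 3 := by nlinarith [sq_nonneg ((n : ℝ) - 1)]
    linarith
  have hB : 6000000 * (∑ k, u k ^ 2) ^ 2 / ((m : ℝ) ^ 2 * (ε / 2) ^ 4) ≤ 3 / 1250 / n := by
    rw [div_le_div_iff₀ (by positivity) hn]
    have h1 : (∑ k, u k ^ 2) ^ 2 ≤ (n * g) ^ 2 := pow_le_pow_left₀ hU0 hu 2
    have h2 : 40000000000 * ((n : ℝ) ^ 3 * g ^ 2) ≤ (m : ℝ) ^ 2 * ε ^ 4 := by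
      rw [← mul_div_assoc, div_le_iff₀ (by positivity)] at hm2
      exact hm2
    have h3 := mul_le_mul_of_nonneg_right h1 hn.le
    have h4 : ((n : ℝ) * g) ^ 2 * n = n ^ 3 * g ^ 2 := by ring
    have h5 : (m : ℝ) ^ 2 * (ε / 2) ^ 4 = (m : ℝ) ^ 2 * ε ^ 4 / 16 := by ring
    rw [h5]
    linarith
  calc _ ≤ (n : ℝ) * (3 / 20000 / n + 3 / 1250 / n) := by gcongr
    _ ≤ 0.005 := by field_simp; norm_num

theorem rpow_five_halves {x : ℝ} (hx : 0 ≤ x) : x ^ (5 / 2 : ℝ) = x ^ 2 * √x := by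
  rw [Real.sqrt_eq_rpow, ← Real.rpow_natCast, ← Real.rpow_add_of_nonneg hx] <;> norm_num

theorem rpow_three_halves {x : ℝ} (hx : 0 ≤ x) : x ^ (3 / 2 : ℝ) = x * √x := by
  conv_rhs => rw [Real.sqrt_eq_rpow, ← Real.rpow_one_add' hx (by norm_num)]
  norm_num

/-- Applied with `N` the sum of the Euclidean norms of the directions. The condition on `g` makes
the real number of samples at least `1`, so rounding it up is absorbed in the constant. -/
theorem totalQueries_le {n : ℕ} {g ε L N : ℝ} (hε : 0 < ε) (h : 0 < n ∧ ε ^ 2 < g)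
    (hL : 0 ≤ L) (hN : N ≤ 3 / 2 * (outerSamples n g ε : ℕ) * √n) :
    10000000 * (√(g * n) / ε) * L * N ≤
      4000000000000 * ((n : ℝ) ^ (5 / 2 : ℝ) * g ^ (3 / 2 : ℝ) / ε ^ 3) * L := by
  have hε2 : 0 < ε ^ 2 := by positivity
  have hg : 0 < g := hε2.trans h.2
  have hn1 : (1 : ℝ) ≤ n := Nat.one_le_cast.2 h.1
  have hs := one_le_sqrt_natCast h.1
  have hnn : √(n : ℝ) * √n = n := Real.mul_self_sqrt (by linarith)
  set q := n * √n * g / ε ^ 2 with hq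
  have hq1 : 1 ≤ q := by
    rw [hq, one_le_div hε2]
    have h1 : 1 ≤ n * √(n : ℝ) := one_le_mul_of_one_le_of_one_le hn1 hs
    nlinarith
  have hm : ((outerSamples n g ε : ℕ) : ℝ) ≤ 200001 * q := by
    rw [outerSamples, if_pos h, ← hq]
    have := (Nat.ceil_lt_add_one (by linarith : 0 ≤ 200000 * q)).le
    linarith
  have hN' : N ≤ 3 / 2 * (200001 * q) * √n := hN.trans (by gcongr)
  rw [rpow_five_halves (by linarith), rpow_three_halves hg.le, Real.sqrt_mul hg.le]
  calc 10000000 * (√g * √n / ε) * L * N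
      ≤ 10000000 * (√g * √n / ε) * L * (3 / 2 * (200001 * q) * √n) := by gcongr
    _ = 3000015000000 * ((n : ℝ) ^ 2 * √n * (g * √g) / ε ^ 3) * L := by
        rw [hq]
        field_simp
        linear_combination 6000030000000 * L * hnn
    _ ≤ _ := by gcongr; norm_num

end ForwardGradient

end

/-! ### The main theorem -/

open ForwardGradient in
theorem mainTheorem5 :
    ∃ (C : ℝ) (c : ℕ), 0 < C ∧ ∀ (n : ℕ) (g ε : ℝ), 0 ≤ g → 0 < ε →
      ∃ c₀ : ℕ, ∀ d c₁ c₂ : ℕ, c₀ ≤ c₁ → c₀ ≤ c₂ →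
        ∃ (m : ℕ) (A : (Fin n → ℝ) → ForwardGradient.QAlgorithm d c₁ c₂),
          (∀ v : Fin n → ℝ, ((A v).queries : ℝ) ≤
            C * (√(g * n) * ForwardGradient.norm2 v / ε) * Real.log (3 + n * √g / ε) ^ c) ∧
          ∀ P : ForwardGradient.Problem d n c₁ c₂, P.gMax ≤ g →
            P.meanForwardGrad = P.gradMeanLoss ∧
            (∀ v : Fin n → ℝ,
              (∀ x, 0 < P.p x → |P.dirDeriv v x| ≤ ForwardGradient.FixedPt.range c₁ c₂) →
              ENNReal.ofReal 0.99 ≤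
                ((A v).law (P.oracle v)).toMeasure {w | |w - P.meanDirDeriv v| ≤ ε}) ∧
            ENNReal.ofReal 0.99 ≤ ForwardGradient.nestedProb P m A fun v w =>
              ‖ForwardGradient.empiricalMean v w - P.meanForwardGrad‖ ≤ ε ∧
              ((∑ i, (A (v i)).queries : ℕ) : ℝ) ≤
                C * ((n : ℝ) ^ (5 / 2 : ℝ) * g ^ (3 / 2 : ℝ) / ε ^ 3) *
                  Real.log (3 + n * √g / ε) ^ c := by
  refine ⟨4000000000000, 1, by norm_num, fun n g ε hg hε => ?_⟩
  set L := Real.log (3 + n * √g / ε) with hLdef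
  have hL : 1 ≤ L := one_le_log_three_add (by positivity)
  set m := outerSamples n g ε with hm
  have hm0 : (0 : ℝ) ≤ m := Nat.cast_nonneg m
  -- All `m` inner runs succeed together with probability at least `0.999`; with the `0.995` for
  -- good directions this exceeds `0.99`. The `+ 1` covers `m = 0`.
  set δ : ℝ := 1 / (1000 * (m + 1)) with hδ
  have hδ0 : 0 < δ := by positivity
  have hδ1 : δ ≤ 1 / 1000 := by
    rw [hδ]
    exact one_div_le_one_div_of_le (by norm_num) (by linarith)
  have hmδ : m * δ ≤ 1 / 1000 := by
    rw [hδ, mul_one_div, div_le_div_iff₀ (by positivity) (by norm_num)]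
    linarith
  -- The term `8 / ε` serves the rounding accuracy; the last term bounds the directional derivatives
  -- along good directions, and the `1` absorbs the `2^{-c₂}` in the range.
  obtain ⟨c₀, hc₀⟩ := pow_unbounded_of_one_lt (8 / ε + 1 + √g * (n * √(2 * m)))
    (one_lt_two : (1 : ℝ) < 2)
  have hr0 : 0 ≤ √g * (n * √(2 * m)) := by positivity
  have hε8 : 0 < 8 / ε := by positivity
  refine ⟨c₀, fun d c₁ c₂ hc₁ hc₂ => ?_⟩
  have hp₁ : (2 : ℝ) ^ c₀ ≤ 2 ^ c₁ := pow_le_pow_right₀ one_le_two hc₁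
  have hp₂ : (2 : ℝ) ^ c₀ ≤ 2 ^ c₂ := pow_le_pow_right₀ one_le_two hc₂
  have hround : ((2 : ℝ) ^ c₂)⁻¹ ≤ ε / 8 := by
    rw [inv_le_comm₀ (by positivity) (by positivity), inv_div]
    linarith
  have hrange : √g * (n * √(2 * m)) ≤ FixedPt.range c₁ c₂ := by
    have : ((2 : ℝ) ^ c₂)⁻¹ ≤ 1 := inv_le_one_of_one_le₀ (one_le_pow₀ one_le_two)
    rw [FixedPt.range]
    linarith
  choose A hAq hA using exists_estimator d n (c₁ := c₁) hg hε hδ0 hround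
  have hq : ∀ v, ((A v).queries : ℝ) ≤ 10000000 * (√(g * n) * norm2 v / ε) * L := by
    intro v
    refine (hAq v).trans ?_
    have h1 := repetitions_le (n := n) hg hε
    rw [← hm, ← hδ, ← hLdef] at h1
    have h2 : 0 ≤ √(g * n) * norm2 v / ε :=
      div_nonneg (mul_nonneg (Real.sqrt_nonneg _) (Real.sqrt_nonneg _)) hε.le
    calc _ ≤ (16 * (22001 * L) + 48000 * L) * (24 * (√(g * n) * norm2 v / ε)) := by
          gcongr
          linarith
      _ ≤ _ := by nlinarith [mul_nonneg h2 (by linarith : 0 ≤ L)]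
  refine ⟨m, A, fun v => ?_, fun P hP => ⟨?_, fun v hv => ?_, ?_⟩⟩
  · rw [pow_one]
    refine (hq v).trans ?_
    have h2 : 0 ≤ √(g * n) * norm2 v / ε :=
      div_nonneg (mul_nonneg (Real.sqrt_nonneg _) (Real.sqrt_nonneg _)) hε.le
    gcongr
    norm_num
  · rw [P.meanForwardGrad_eq, P.gradMeanLoss_eq]
  · refine le_trans (ENNReal.ofReal_le_ofReal (by norm_num; linarith))
      ((hA v P hP hv).trans (measure_mono fun w hw => ?_))
    rw [Set.mem_ofPred_eq] at hw ⊢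
    linarith
  · rw [P.meanForwardGrad_eq, pow_one]
    -- Otherwise `m = 0` and the estimate is `0`, which is accurate because every coordinate of the
    -- mean gradient is at most `√g ≤ ε`, or there are no coordinates.
    by_cases h : 0 < n ∧ ε ^ 2 < g
    · have hmpos : 0 < m := by
        rw [hm, outerSamples, if_pos h, Nat.ceil_pos]
        have : (0 : ℝ) < n := Nat.cast_pos.2 h.1
        have : 0 < g := (by positivity : 0 < ε ^ 2).trans h.2
        positivity
      refine le_trans (ENNReal.ofReal_le_ofReal ?_) (le_nestedProb P A _
        (measurableSet_goodDirections m P.meanGrad (ε / 2))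
        (S := fun v i => {w | |w - P.meanDirDeriv (v i)| ≤ ε / 4}) (δ := δ) (by linarith) (by linarith)
        (measure_compl_goodDirections_outerSamples_le hε h (sum_meanGrad_sq_le hg hP)) ?_ ?_)
      · norm_num
        linarith
      · intro v hv i
        refine hA (v i) P hP fun x hx => ((P.abs_dirDeriv_le_sum hP hx (v i)).trans ?_).trans hrange
        gcongr
        refine (Finset.sum_le_sum fun k _ =>
          abs_apply_le_of_mem_goodDirections hmpos hv i k).trans (le_of_eq ?_)
        simp
      · intro v hv w hw
        refine ⟨norm_empiricalMean_sub_le hmpos hε hv fun i => ?_, ?_⟩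
        · rw [← P.meanDirDeriv_eq]
          exact hw i
        · refine le_trans ?_ (totalQueries_le hε h (by linarith : 0 ≤ L)
            (sum_norm2_le_of_mem_goodDirections hmpos hv))
          push_cast
          refine (Finset.sum_le_sum fun i _ => hq (v i)).trans (le_of_eq ?_)
          rw [Finset.mul_sum]
          exact Finset.sum_congr rfl fun i _ => by ring
    · have hmz : m = 0 := by rw [hm, outerSamples, if_neg h]
      have : IsEmpty (Fin m) := by rw [hmz]; infer_instance
      refine le_trans (ENNReal.ofReal_le_ofReal ?_) (le_nestedProb P A _ MeasurableSet.univ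
        (S := fun _ _ => Set.univ) (δ := 0) (γ := 0) zero_le_one (by simp) (by simp)
        (fun v _ i => isEmptyElim i) fun v _ w _ => ⟨?_, ?_⟩)
      · norm_num
      · rw [pi_norm_le_iff_of_nonneg hε.le]
        intro k
        have hgε : g ≤ ε ^ 2 := not_lt.1 fun hlt => h ⟨Fin.pos k, hlt⟩
        have h1 := P.abs_meanGrad_le hP k
        have h2 := (Real.sqrt_le_sqrt hgε).trans_eq (Real.sqrt_sq hε.le)
        simp only [empiricalMean, Finset.univ_eq_empty, Finset.sum_empty, smul_zero, zero_sub,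
          Pi.neg_apply, norm_neg, Real.norm_eq_abs]
        linarith
      · simp only [Finset.univ_eq_empty, Finset.sum_empty, Nat.cast_zero]
        positivity
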